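/- Let $\mathbb K$ be a field of characteristic zero, $n\ge 1$, $\mathbb K[X]=\mathbb K[x_0,\dots,x_{n-1}]$ with $x_0>x_1>\dots>x_{n-1}$. Let $G$ be a graph on $X$ for which this ordering is a perfect elimination ordering: for each $l$ the set $X_l$, consisting of $x_l$ and its neighbours smaller than $x_l$, is a clique. Let $F\subset\mathbb K[X]$ be a finite set supported on $G$ (any two distinct variables occurring in a common $f\in F$ are adjacent in $G$). The parent of $x_l$ is its largest neighbour among those smaller than $x_l$, if any; this defines the elimination tree (a forest if $G$ is disconnected). **Systems.** A polynomial system is a pair $\mathfrak F=(F,H)$ of finite polynomial sets, with $\mathbf Z(\mathfrak F)=\{x\in\overline{\mathbb K}^n: f(x)=0\ (f\in F),\ h(x)\ne 0\ (h\in H)\}$; $\mathfrak F_{\geq p}$ is its part in $\mathbb K[x_p,x_{p+1},\dots]$, and $+$ is componentwise union. The main variable of a non-constant polynomial is its largest variable, and its initial is its leading coefficient in that variable. A set $T$ of non-constant polynomials is triangular if its elements have distinct main variables. A regular system is $(T,U)$ with $T$ triangular and $0\notin U$ such that for every $k$: (i) $T$ and $U$ do not both contain a polynomial with main variable $x_k$;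 (ii) the initial of each $f\in T\cup U$ with main variable $x_k$ vanishes nowhere on $\mathbf Z((T,U)_{\geq k+1})$. It is squarefree if moreover $f(x_k,\hat x)\in\overline{\mathbb K}[x_k]$ is squarefree for all such $f$ and all $\hat x\in\mathbf Z((T,U)_{\geq k+1})$. A triangular decomposition of $\mathfrak F$ is a collection of regular systems $\mathfrak T$ with $\mathbf Z(\mathfrak F)=\bigcup\mathbf Z(\mathfrak T)$; it is squarefree if all $\mathfrak T$ are. **Networks.** A $G$-chordal network is a finite directed graph whose nodes are polynomial sets, each with a rank $l$ such that the node lies in $\mathbb K[X_l]$, and whose arcs join a node of rank $l$ to a node of rank $p$ only if $x_p$ is the parent of $x_l$. It is triangular if each node is a single polynomial that is $0$ (identified with the empty set) or has main variable $x_{\mathrm{rank}}$. A chain consists of one node of each rank, with an arc from the rank $l$ node to the rank $p$ node whenever $x_p$ is the parent of $x_l$. The same terms are used when nodes are polynomial systems. **Chordal triangularization.** Start with one node $(F\cap\mathbb K[X_l],\emptyset)$ of each rank $l$ and the arcs of the elimination tree. For $l=0,\dots,n-1$: 1. Triangulate: replace each rank $l$ node by the members of a finite triangular decomposition of it, formed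 in $\mathbb K[X_l]$; each of them inherits all the arcs. 2. Optionally merge pairs of rank $l$ nodes with the same equation ideal, the same inequations and the same outgoing arcs. 3. If $x_l$ has a parent $x_p$, eliminate: for each arc $(\mathfrak T,\mathfrak F_p)$ with $\mathfrak T$ of rank $l$ create a rank $p$ node $\mathfrak F_p'=\mathfrak F_p+\mathfrak T_{\geq p}$, which inherits the arcs at $\mathfrak F_p$ other than those coming from rank $l$, and replace the arc by $(\mathfrak T,\mathfrak F'_p)$; then remove $\mathfrak T_{\geq p}$ from each rank $l$ node $\mathfrak T$; then optionally merge rank $p$ nodes as in 2. 4. Optionally merge pairs of rank $l$ nodes with the same equation ideal, the same inequations and the same incoming arcs. Finally, remove the inequations from all nodes to get the output network $\mathcal N$. **Theorem.** Whatever decompositions and merges are chosen, the following hold. 1. No run gets stuck: at the start of each round $l$, each rank $l$ node has a finite triangular decomposition in $\mathbb K[X_l]$, even a squarefree one. In particular complete runs exist, also with all triangulations squarefree. 2. For every complete run, $\mathcal N$ is a triangular $G$-chordal network, and its chains give a triangular decomposition of $F$. That is: with the inequations of their nodes kept, the chains form a triangular decomposition of $(F,\emptyset)$ into regular systems; with the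 inequations removed, each chain $T$ is a regular chain and $\mathbf V(F)=\bigcup_T\mathbf W(T)$ over all chains. Here $\mathbf W(T)=\mathbf V(T)\setminus\mathbf V(h)$ with $h$ the product of the initials of $T$, and a triangular set $T$ is a regular chain if for every polynomial $f$, $f\in\langle T\rangle:h^\infty$ if and only if the pseudo-remainder of $f$ by $T$ is $0$. 3. If all triangulation operations of the run are squarefree, then the decomposition of $F$ into regular systems given by the chains is squarefree. -/

import Mathlib

/-!
Variables are indexed by `Fin n`, with the order `x_0 > x_1 > ... > x_{n-1}`:
a smaller index is a larger variable.
-/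

namespace ChordalNet

noncomputable section

/-! ### Main variables and initials -/

/-- `x_k` is the main variable of `f`, i.e. the largest variable (smallest index) occurring
in `f`. A constant polynomial has no main variable. -/
def IsMainVar {K : Type*} [Field K] {n : ℕ} (f : MvPolynomial (Fin n) K) (k : Fin n) : Prop :=
  k ∈ f.vars ∧ ∀ i ∈ f.vars, k ≤ i

/-- The leading coefficient of `f`, viewed as a univariate polynomial in `x_k`. -/
def leadCoeffIn {K : Type*} [Field K] {n : ℕ} (k : Fin n) (f : MvPolynomial (Fin n) K) :
    MvPolynomial (Fin n) K :=
  ∑ m ∈ f.support with m k = f.degreeOf k, MvPolynomial.monomial (m.erase k) (f.coeff m)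

/-- The initial of a non-constant polynomial: its leading coefficient with respect to its main
variable. (The value at a constant is never used.) -/
def initial {K : Type*} [Field K] {n : ℕ} (f : MvPolynomial (Fin n) K) :
    MvPolynomial (Fin n) K :=
  if h : f.vars.Nonempty then leadCoeffIn (f.vars.min' h) f else f

/-- The univariate polynomial `f(x_k, x̂)` obtained from `f` by substituting the coordinates of
the point `x` for all variables other than `x_k`. -/
def specialize {K : Type*} [Field K] {n : ℕ} (k : Fin n) (x : Fin n → AlgebraicClosure K)
    (f : MvPolynomial (Fin n) K) : Polynomial (AlgebraicClosure K) :=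
  MvPolynomial.aeval (fun i => if i = k then Polynomial.X else Polynomial.C (x i)) f

/-! ### Polynomial systems -/

/-- A polynomial system: finitely many equations and finitely many inequations. -/
@[ext]
structure PolySystem (K : Type*) [Field K] (n : ℕ) where
  eqs : Finset (MvPolynomial (Fin n) K)
  ineqs : Finset (MvPolynomial (Fin n) K)

/-- The variety of a polynomial set, in the affine space over the algebraic closure. -/
def variety {K : Type*} [Field K] {n : ℕ} (F : Finset (MvPolynomial (Fin n) K)) :
    Set (Fin n → AlgebraicClosure K) :=
  {x | ∀ f ∈ F, MvPolynomial.aeval x f = 0}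

namespace PolySystem

/-- The quasi-variety of a polynomial system. -/
def zeros {K : Type*} [Field K] {n : ℕ} (S : PolySystem K n) :
    Set (Fin n → AlgebraicClosure K) :=
  {x | (∀ f ∈ S.eqs, MvPolynomial.aeval x f = 0) ∧
       (∀ h ∈ S.ineqs, MvPolynomial.aeval x h ≠ 0)}

open Classical in
/-- The part of a system in the variables `x_p, x_{p+1}, ...`. -/
def elim {K : Type*} [Field K] {n : ℕ} (p : ℕ) (S : PolySystem K n) : PolySystem K n where
  eqs := S.eqs.filter (fun f => f ∈ MvPolynomial.supported K {i : Fin n | p ≤ (i : ℕ)})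
  ineqs := S.ineqs.filter (fun f => f ∈ MvPolynomial.supported K {i : Fin n | p ≤ (i : ℕ)})

open Classical in
/-- Concatenation of polynomial systems. -/
def concat {K : Type*} [Field K] {n : ℕ} (S S' : PolySystem K n) : PolySystem K n where
  eqs := S.eqs ∪ S'.eqs
  ineqs := S.ineqs ∪ S'.ineqs

open Classical in
/-- Difference of polynomial systems. -/
def diff {K : Type*} [Field K] {n : ℕ} (S S' : PolySystem K n) : PolySystem K n where
  eqs := S.eqs \ S'.eqs
  ineqs := S.ineqs \ S'.ineqs

/-- All polynomials of the system lie in the polynomial ring in the variables `X`. -/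
def SupportedIn {K : Type*} [Field K] {n : ℕ} (S : PolySystem K n) (X : Set (Fin n)) : Prop :=
  (∀ f ∈ S.eqs, f ∈ MvPolynomial.supported K X) ∧
  (∀ f ∈ S.ineqs, f ∈ MvPolynomial.supported K X)

end PolySystem

/-! ### Regular systems, regular chains, triangular decompositions -/

/-- A triangular set: non-constant polynomials with distinct main variables. -/
def IsTriangularSet {K : Type*} [Field K] {n : ℕ} (T : Finset (MvPolynomial (Fin n) K)) : Prop :=
  (∀ f ∈ T, ∃ k, IsMainVar f k) ∧
  (∀ f ∈ T, ∀ g ∈ T, ∀ k, IsMainVar f k → IsMainVar g k → f = g)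

/-- Regular systems. Points of the quasi-variety of `S.elim (k+1)` are taken in the full affine
space; only their coordinates of index at least `k+1` matter. -/
structure IsRegularSystem {K : Type*} [Field K] {n : ℕ} (S : PolySystem K n) : Prop where
  triangular : IsTriangularSet S.eqs
  ineqs_ne_zero : ∀ u ∈ S.ineqs, u ≠ 0
  eqs_or_ineqs : ∀ k : Fin n,
    (∀ f ∈ S.eqs, ¬ IsMainVar f k) ∨ (∀ f ∈ S.ineqs, ¬ IsMainVar f k)
  initial_ne_zero : ∀ (k : Fin n) (f : MvPolynomial (Fin n) K), f ∈ S.eqs ∨ f ∈ S.ineqs →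
    IsMainVar f k → ∀ x ∈ (S.elim ((k : ℕ) + 1)).zeros, MvPolynomial.aeval x (initial f) ≠ 0

/-- Squarefree regular systems. -/
structure IsSquarefreeRegularSystem {K : Type*} [Field K] {n : ℕ} (S : PolySystem K n) : Prop
    extends IsRegularSystem S where
  specialize_squarefree : ∀ (k : Fin n) (f : MvPolynomial (Fin n) K),
    f ∈ S.eqs ∨ f ∈ S.ineqs → IsMainVar f k →
    ∀ x ∈ (S.elim ((k : ℕ) + 1)).zeros, Squarefree (specialize k x f)

/-- A triangular decomposition of a polynomial system into regular systems. -/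
def IsTriangularDecomposition {K : Type*} [Field K] {n : ℕ} (S : PolySystem K n)
    (𝒯 : Set (PolySystem K n)) : Prop :=
  (∀ T ∈ 𝒯, IsRegularSystem T) ∧ S.zeros = ⋃ T ∈ 𝒯, T.zeros

/-- A triangular decomposition all of whose regular systems are squarefree. -/
def IsSquarefreeTriangularDecomposition {K : Type*} [Field K] {n : ℕ} (S : PolySystem K n)
    (𝒯 : Set (PolySystem K n)) : Prop :=
  (∀ T ∈ 𝒯, IsSquarefreeRegularSystem T) ∧ S.zeros = ⋃ T ∈ 𝒯, T.zeros

/-- The product of the initials of the polynomials of a set. -/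
def initialProd {K : Type*} [Field K] {n : ℕ} (T : Finset (MvPolynomial (Fin n) K)) :
    MvPolynomial (Fin n) K :=
  ∏ t ∈ T, initial t

/-- The quasi-component `V(T) \ V(h)`, `h` the product of the initials. -/
def quasiComponent {K : Type*} [Field K] {n : ℕ} (T : Finset (MvPolynomial (Fin n) K)) :
    Set (Fin n → AlgebraicClosure K) :=
  variety T \ variety {initialProd T}

/-- Membership in the saturated ideal `⟨T⟩ : h^∞`. -/
def MemSat {K : Type*} [Field K] {n : ℕ} (T : Finset (MvPolynomial (Fin n) K))
    (f : MvPolynomial (Fin n) K) : Prop :=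
  ∃ N : ℕ, initialProd T ^ N * f ∈ Ideal.span (T : Set (MvPolynomial (Fin n) K))

/-- `r` is the pseudo-remainder of `f` by `g` with respect to `x_k`, the main variable of `g`. -/
def IsPseudoRem {K : Type*} [Field K] {n : ℕ} (k : Fin n) (f g r : MvPolynomial (Fin n) K) :
    Prop :=
  (f.degreeOf k < g.degreeOf k ∧ r = f) ∨
  (g.degreeOf k ≤ f.degreeOf k ∧ r.degreeOf k < g.degreeOf k ∧
    ∃ q, initial g ^ (f.degreeOf k - g.degreeOf k + 1) * f = q * g + r)

/-- `r` is the pseudo-remainder of `f` by the triangular set `T`: one pseudo-divides successively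
by the elements of `T`, in decreasing order of their main variables. The polynomial `s k` is the
result after treating the main variables `x_0, ..., x_{k-1}`. -/
def IsPseudoRemSet {K : Type*} [Field K] {n : ℕ} (T : Finset (MvPolynomial (Fin n) K))
    (f r : MvPolynomial (Fin n) K) : Prop :=
  ∃ s : Fin (n + 1) → MvPolynomial (Fin n) K, s 0 = f ∧ s (Fin.last n) = r ∧
    ∀ k : Fin n,
      (∀ t ∈ T, IsMainVar t k → IsPseudoRem k (s k.castSucc) t (s k.succ)) ∧
      ((∀ t ∈ T, ¬ IsMainVar t k) → s k.succ = s k.castSucc)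

/-- Regular chains: triangular sets such that `f` is in the saturated ideal if and only if its
pseudo-remainder is zero. -/
def IsRegularChain {K : Type*} [Field K] {n : ℕ} (T : Finset (MvPolynomial (Fin n) K)) : Prop :=
  IsTriangularSet T ∧ ∀ f, MemSat T f ↔ IsPseudoRemSet T f 0

/-- A triangular decomposition of a polynomial set into regular chains. -/
def IsRegularChainDecomposition {K : Type*} [Field K] {n : ℕ}
    (F : Finset (MvPolynomial (Fin n) K)) (𝒯 : Set (Finset (MvPolynomial (Fin n) K))) : Prop :=
  (∀ T ∈ 𝒯, IsRegularChain T) ∧ variety F = ⋃ T ∈ 𝒯, quasiComponent T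

/-! ### Chordal graphs and elimination trees -/

/-- The set `X_l`: the vertex `x_l` and its smaller neighbours. -/
def cliqueAt {n : ℕ} (G : SimpleGraph (Fin n)) (l : Fin n) : Set (Fin n) :=
  insert l {m | G.Adj l m ∧ l < m}

/-- The ordering `x_0 > ... > x_{n-1}` is a perfect elimination ordering of `G`. -/
def IsPerfectEliminationOrdering {n : ℕ} (G : SimpleGraph (Fin n)) : Prop :=
  ∀ l, G.IsClique (cliqueAt G l)

/-- The sparsity graph of a polynomial set: two variables are adjacent if some polynomial of the
set contains both. -/
def sparsityGraph {K : Type*} [Field K] {n : ℕ} (F : Finset (MvPolynomial (Fin n) K)) :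
    SimpleGraph (Fin n) where
  Adj i j := i ≠ j ∧ ∃ f ∈ F, i ∈ f.vars ∧ j ∈ f.vars
  symm := ⟨fun _ _ ⟨h, f, hf, hi, hj⟩ => ⟨h.symm, f, hf, hj, hi⟩⟩
  loopless := ⟨fun _ h => h.1 rfl⟩

/-- `F` is supported on the chordal graph `G`: the graph `G`, with the given ordering as a perfect
elimination ordering, is a chordal completion of the sparsity graph of `F`. -/
def IsSupportedOn {K : Type*} [Field K] {n : ℕ} (F : Finset (MvPolynomial (Fin n) K))
    (G : SimpleGraph (Fin n)) : Prop :=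
  IsPerfectEliminationOrdering G ∧ sparsityGraph F ≤ G

/-- `x_p` is the parent of `x_l` in the elimination tree: the largest neighbour of `x_l` among
those smaller than `x_l`. If `G` is disconnected, this is a forest. -/
def IsParent {n : ℕ} (G : SimpleGraph (Fin n)) (l p : Fin n) : Prop :=
  G.Adj l p ∧ l < p ∧ ∀ m, G.Adj l m → l < m → p ≤ m

/-! ### Networks -/

/-- A finite directed graph whose nodes carry a rank in `{0, ..., n-1}` and a content of type
`α` (a polynomial system or a polynomial set). -/
structure Network (n : ℕ) (α : Type*) where
  Node : Type
  finite : Finite Node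
  rank : Node → Fin n
  content : Node → α
  Arc : Node → Node → Prop

/-- Apply a function to the content of each node. -/
def Network.map {n : ℕ} {α β : Type*} (φ : α → β) (N : Network n α) : Network n β where
  Node := N.Node
  finite := N.finite
  rank := N.rank
  content v := φ (N.content v)
  Arc := N.Arc

/-- `G`-chordal networks: nodes are polynomial sets supported on the cliques `X_l`, and arcs
follow the elimination tree. -/
def IsChordalNetwork {K : Type*} [Field K] {n : ℕ} (G : SimpleGraph (Fin n))
    (N : Network n (Finset (MvPolynomial (Fin n) K))) : Prop :=
  (∀ v, ∀ f ∈ N.content v, f ∈ MvPolynomial.supported K (cliqueAt G (N.rank v))) ∧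
  (∀ v w, N.Arc v w → IsParent G (N.rank v) (N.rank w))

/-- Triangular networks: each node is a single polynomial which is zero (represented by the empty
polynomial set) or whose largest variable is given by the rank. -/
def IsTriangularNetwork {K : Type*} [Field K] {n : ℕ}
    (N : Network n (Finset (MvPolynomial (Fin n) K))) : Prop :=
  ∀ v, N.content v = ∅ ∨ ∃ f, N.content v = {f} ∧ IsMainVar f (N.rank v)

/-- Chains: one node of each rank, joined by arcs along the elimination tree. -/
def IsChain {n : ℕ} {α : Type*} (G : SimpleGraph (Fin n)) (N : Network n α)
    (c : Fin n → N.Node) : Prop :=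
  (∀ l, N.rank (c l) = l) ∧ ∀ l p, IsParent G l p → N.Arc (c l) (c p)

open Classical in
/-- The union of the polynomial sets of the nodes of each chain. -/
def chainSets {K : Type*} [Field K] {n : ℕ} (G : SimpleGraph (Fin n))
    (N : Network n (Finset (MvPolynomial (Fin n) K))) : Set (Finset (MvPolynomial (Fin n) K)) :=
  {T | ∃ c, IsChain G N c ∧ T = Finset.univ.biUnion (fun l => N.content (c l))}

open Classical in
/-- The concatenation of the polynomial systems of the nodes of each chain. -/
def chainSystems {K : Type*} [Field K] {n : ℕ} (G : SimpleGraph (Fin n))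
    (N : Network n (PolySystem K n)) : Set (PolySystem K n) :=
  {T | ∃ c, IsChain G N c ∧
    T = ⟨Finset.univ.biUnion (fun l => (N.content (c l)).eqs),
         Finset.univ.biUnion (fun l => (N.content (c l)).ineqs)⟩}

/-! ### Chordal triangularization -/

open Classical in
/-- The induced network: one node `(F ∩ K[X_l], ∅)` of each rank `l`, arcs as in the elimination
tree. -/
def induced {K : Type*} [Field K] {n : ℕ} (G : SimpleGraph (Fin n))
    (F : Finset (MvPolynomial (Fin n) K)) : Network n (PolySystem K n) where
  Node := Fin n
  finite := inferInstance
  rank := id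
  content l := ⟨F.filter (fun f => f ∈ MvPolynomial.supported K (cliqueAt G l)), ∅⟩
  Arc := IsParent G

/-- Replace each node `v` by the nodes `T v 0, ..., T v (k v - 1)` of the same rank. Any node that
was connected to `v` is then connected to each of the new nodes. -/
def replaceNodes {K : Type*} [Field K] {n : ℕ} (N : Network n (PolySystem K n))
    (k : N.Node → ℕ) (T : (v : N.Node) → Fin (k v) → PolySystem K n) :
    Network n (PolySystem K n) where
  Node := Σ v, Fin (k v)
  finite := by have := N.finite; infer_instance
  rank a := N.rank a.1
  content a := T a.1 a.2
  Arc a b := N.Arc a.1 b.1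

/-- Triangulation of all nodes of rank `l`: each such node is replaced by the members of a
decomposition of it that satisfies `D` and is formed in `K[X_l]`; all other nodes stay as they
are. The relation `D` is `IsTriangularDecomposition` or its squarefree version. -/
def Triangulate {K : Type*} [Field K] {n : ℕ} (G : SimpleGraph (Fin n))
    (D : PolySystem K n → Set (PolySystem K n) → Prop) (l : Fin n)
    (N N' : Network n (PolySystem K n)) : Prop :=
  ∃ (k : N.Node → ℕ) (T : (v : N.Node) → Fin (k v) → PolySystem K n),
    (∀ v, N.rank v = l →
      D (N.content v) (Set.range (T v)) ∧ ∀ i, (T v i).SupportedIn (cliqueAt G l)) ∧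
    (∀ v, N.rank v ≠ l → k v = 1 ∧ ∀ i, T v i = N.content v) ∧
    N' = replaceNodes N k T

/-- The new nodes in the elimination of rank `l`: one for each arc `(v, w)` with `v` of
rank `l`. -/
abbrev ElimArc {n : ℕ} {α : Type*} (N : Network n α) (l : Fin n) : Type :=
  {a : N.Node × N.Node // N.rank a.1 = l ∧ N.Arc a.1 a.2}

/-- The old node from which a node arises in the elimination of rank `l`. -/
def elimBase {n : ℕ} {α : Type*} (N : Network n α) (l : Fin n) :
    N.Node ⊕ ElimArc N l → N.Node
  | .inl v => v
  | .inr a => a.1.2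

open Classical in
/-- Elimination of all nodes of rank `l`, where `x_p` is the parent of `x_l`. For each arc `(v, w)`
with `v` of rank `l` there is a new node of rank `p`, the concatenation of `w` with the part of `v`
in the variables `x_p, x_{p+1}, ...`; the arc `(v, w)` is substituted by an arc from `v` to the new
node, which inherits all other arcs at `w` (those going out of `w`, and those coming into `w` from
nodes whose rank is not `l`). The transferred part is removed from `v`. -/
def eliminate {K : Type*} [Field K] {n : ℕ} (N : Network n (PolySystem K n)) (l p : Fin n) :
    Network n (PolySystem K n) where
  Node := N.Node ⊕ ElimArc N l
  finite := by have := N.finite; infer_instance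
  rank a := N.rank (elimBase N l a)
  content
    | .inl v =>
        if N.rank v = l then (N.content v).diff ((N.content v).elim p) else N.content v
    | .inr a => (N.content a.1.2).concat ((N.content a.1.1).elim p)
  Arc a b := N.Arc (elimBase N l a) (elimBase N l b) ∧
    (N.rank (elimBase N l a) = l → ∃ e : ElimArc N l, b = .inr e ∧ a = .inl e.1.1)

/-- Merge node `v` into node `u`: all arcs at `v` become arcs at `u`, and `v` is deleted. -/
def merge {K : Type*} [Field K] {n : ℕ} (N : Network n (PolySystem K n)) (u v : N.Node) :
    Network n (PolySystem K n) where
  Node := {w : N.Node // w ≠ v}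
  finite := by have := N.finite; infer_instance
  rank a := N.rank a.1
  content a := N.content a.1
  Arc a b := N.Arc a.1 b.1 ∨ (b.1 = u ∧ N.Arc a.1 v) ∨ (a.1 = u ∧ N.Arc v b.1)

/-- Two systems define the same ideal and have the same inequations. -/
def Mergeable {K : Type*} [Field K] {n : ℕ} (S S' : PolySystem K n) : Prop :=
  Ideal.span (S.eqs : Set (MvPolynomial (Fin n) K)) =
    Ideal.span (S'.eqs : Set (MvPolynomial (Fin n) K)) ∧ S.ineqs = S'.ineqs

/-- Any number of merges of pairs of rank `l` nodes with the same outgoing arcs. -/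
inductive MergeOut {K : Type*} [Field K] {n : ℕ} (l : Fin n) :
    Network n (PolySystem K n) → Network n (PolySystem K n) → Prop
  | refl (N : Network n (PolySystem K n)) : MergeOut l N N
  | step (N N' : Network n (PolySystem K n)) (u v : N.Node) (hne : u ≠ v)
      (hu : N.rank u = l) (hv : N.rank v = l) (hc : Mergeable (N.content u) (N.content v))
      (harc : ∀ w, N.Arc u w ↔ N.Arc v w) (h : MergeOut l (merge N u v) N') : MergeOut l N N'

/-- Any number of merges of pairs of rank `l` nodes with the same incoming arcs. -/
inductive MergeIn {K : Type*} [Field K] {n : ℕ} (l : Fin n) :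
    Network n (PolySystem K n) → Network n (PolySystem K n) → Prop
  | refl (N : Network n (PolySystem K n)) : MergeIn l N N
  | step (N N' : Network n (PolySystem K n)) (u v : N.Node) (hne : u ≠ v)
      (hu : N.rank u = l) (hv : N.rank v = l) (hc : Mergeable (N.content u) (N.content v))
      (harc : ∀ w, N.Arc w u ↔ N.Arc w v) (h : MergeIn l (merge N u v) N') : MergeIn l N N'

/-- Elimination of the rank `l` nodes followed by merges at the rank of the parent; nothing is done
if `x_l` has no parent (in the connected case: if `l = n - 1`). -/
def EliminatePhase {K : Type*} [Field K] {n : ℕ} (G : SimpleGraph (Fin n)) (l : Fin n)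
    (N N' : Network n (PolySystem K n)) : Prop :=
  (∃ p, IsParent G l p ∧ MergeOut p (eliminate N l p) N') ∨
  ((∀ p, ¬ IsParent G l p) ∧ N' = N)

/-- The `l`-th round of chordal triangularization. -/
def Round {K : Type*} [Field K] {n : ℕ} (G : SimpleGraph (Fin n))
    (D : PolySystem K n → Set (PolySystem K n) → Prop) (l : Fin n)
    (N N' : Network n (PolySystem K n)) : Prop :=
  ∃ N₁ N₂ N₃, Triangulate G D l N N₁ ∧ MergeOut l N₁ N₂ ∧ EliminatePhase G l N₂ N₃ ∧
    MergeIn l N₃ N'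

/-- `AfterRounds G D F l N`: some run of chordal triangularization on the input `F`, `G`, with all
triangulation operations satisfying `D`, has the network `N` after the rounds `0, ..., l-1`. -/
inductive AfterRounds {K : Type*} [Field K] {n : ℕ} (G : SimpleGraph (Fin n))
    (D : PolySystem K n → Set (PolySystem K n) → Prop) (F : Finset (MvPolynomial (Fin n) K)) :
    ℕ → Network n (PolySystem K n) → Prop
  | start : AfterRounds G D F 0 (induced G F)
  | round (l : Fin n) (N N' : Network n (PolySystem K n)) (h : AfterRounds G D F l N)
      (hr : Round G D l N N') : AfterRounds G D F ((l : ℕ) + 1) N'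

/-- Termination step: remove the inequations from the nodes. -/
def dropIneqs {K : Type*} [Field K] {n : ℕ} (N : Network n (PolySystem K n)) :
    Network n (Finset (MvPolynomial (Fin n) K)) :=
  N.map PolySystem.eqs

end

end ChordalNet

/-!
The proof rests on three facts about polynomial systems and on one invariant of networks.

*Univariate view.* `toPoly k f` is `f` as a polynomial in `x_k`. Its degree, leading coefficient
and specializations are the degree of `f` in `x_k`, the initial (if `x_k` is the main variable)
and `specialize k x f`.

*Regular systems give regular chains* (`IsRegularSystem.isRegularChain`). For a regular system
`(T, U)` with `u` the product of `U`, consider the ideal `⟨T⟩ : u^∞` (`systemIdeal`). By the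
Nullstellensatz, a polynomial without zeros on `Z(T, U)` is a nonzerodivisor modulo this ideal.
Hence the leading coefficients of the polynomials with main variable `x_k` are nonzerodivisors
modulo the ideal of the part of the system in the variables after `x_k`, and a comparison of
degrees shows that an element of the ideal that is reduced in `x_k` has all its coefficients in the
next ideal (`coeff_mem_systemIdeal_elim`). By induction, a reduced element is zero, so that the
pseudo-remainder of an element of the ideal is zero. It follows that the ideal is the saturated
ideal of `T`, and, again by the Nullstellensatz, that polynomials which vanish on `Z(T, U)` vanish
on the quasi-component `W(T)`. This is why the inequations can be dropped in the end.

*Squarefree decompositions exist* (`exists_isSquarefreeTriangularDecomposition`). The variables are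
eliminated one by one. In each step there is a system of univariate polynomials over a Noetherian
ring `R` of parameters, and one argues by Noetherian induction on closed sets of parameters
(`exists_fiber_decomposition`). At the generic point of an irreducible closed set, the system is
equivalent to a single squarefree equation or inequation over the residue field, by greatest
common divisors and squarefree parts; characteristic zero makes the latter separable. Clearing
denominators, the equivalence persists on a nonempty open subset (`exists_generic_pieces`).

*The invariant* (`NetworkInvariant`). The rounds and merges preserve the following properties. Each
zero of `F` lies on some chain. Each common zero of the nodes of an upward path that starts at rank
`l` and ends at a root is a zero of `F ∩ K[X_l]`. In a treated node of rank `l`, what is left has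
main variable `x_l`, and its initial vanishes nowhere (and its specializations are squarefree) on
the zeros of the upward paths above the node. Merges create new chains, but no essentially new
upward paths: this is what the conditions on outgoing and incoming arcs are for. Elimination keeps
the path property because the part taken out of a node reappears in each of its new parents. When
all rounds are done, the invariant says that the system of each chain is regular, and that the
chains have the right zeros.
-/

namespace ChordalNet

open MvPolynomial

noncomputable section

/-! ### Polynomials as univariate polynomials in one of the variables -/

/-- `f` viewed as a univariate polynomial in `x_k`; the coefficients are polynomials in the other
variables, but are kept in the ring of all variables. -/
def toPoly {K : Type*} [Field K] {n : ℕ} (k : Fin n) :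
    MvPolynomial (Fin n) K →ₐ[K] Polynomial (MvPolynomial (Fin n) K) :=
  aeval (fun i => if i = k then Polynomial.X else Polynomial.C (X i))

section

variable {K : Type*} [Field K] {n : ℕ}

lemma toPoly_monomial (k : Fin n) (m : Fin n →₀ ℕ) (a : K) :
    toPoly k (monomial m a) =
      Polynomial.C (monomial (m.erase k) a) * Polynomial.X ^ (m k) := by
  rw [toPoly, aeval_monomial, monomial_eq]
  have h1 : (m.prod fun i e => ((if i = k then Polynomial.X else
        Polynomial.C (X i) : Polynomial (MvPolynomial (Fin n) K))) ^ e) =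
      (m.erase k).prod (fun i e => (Polynomial.C (X i : MvPolynomial (Fin n) K)) ^ e) *
        Polynomial.X ^ (m k) := by
    conv_lhs => rw [← Finsupp.erase_add_single k m]
    rw [Finsupp.prod_add_index' (by simp) (by intros; rw [pow_add])]
    congr 1
    · refine Finsupp.prod_congr fun i hi => ?_
      have : i ≠ k := by rintro rfl; simp at hi
      simp [this]
    · simp
  rw [h1, ← mul_assoc]
  congr 1
  rw [map_mul, map_finsuppProd]
  simp [IsScalarTower.algebraMap_apply K (MvPolynomial (Fin n) K), algebraMap_eq]

/-- The coefficients of `toPoly k f`, monomial by monomial. Degrees and variables of the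
coefficients are read off from this. -/
lemma coeff_toPoly_coeff (k : Fin n) (f : MvPolynomial (Fin n) K) (i : ℕ) (e : Fin n →₀ ℕ) :
    ((toPoly k f).coeff i).coeff e =
      if e k = 0 then f.coeff (e + Finsupp.single k i) else 0 := by
  induction f using MvPolynomial.induction_on' with
  | add p q hp hq =>
    rw [map_add, Polynomial.coeff_add, coeff_add, hp, hq]
    split_ifs <;> simp
  | monomial m a =>
    rw [toPoly_monomial, Polynomial.coeff_C_mul, Polynomial.coeff_X_pow]
    by_cases h : e + Finsupp.single k i = m ∧ e k = 0
    · obtain ⟨rfl, h0⟩ := h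
      have : (Finsupp.erase k (e + Finsupp.single k i)) = e := by
        ext j
        by_cases hj : j = k
        · subst hj; simp [h0]
        · simp [Finsupp.erase_ne hj]
      simp [h0, this]
    · have h2 : (if e k = 0 then coeff (e + Finsupp.single k i) (monomial m a) else 0) = 0 := by
        rw [coeff_monomial]
        split_ifs with h3 h4
        · exact absurd ⟨h4.symm, h3⟩ h
        · rfl
        · rfl
      rw [h2]
      by_cases h3 : i = m k
      · rw [if_pos h3, mul_one, coeff_monomial, if_neg]
        rintro rfl
        apply h
        subst h3
        exact ⟨Finsupp.erase_add_single k m, by simp⟩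
      · simp [h3]

lemma coeff_toPoly (k : Fin n) (f : MvPolynomial (Fin n) K) (i : ℕ) :
    (toPoly k f).coeff i = ∑ m ∈ f.support with m k = i, monomial (m.erase k) (f.coeff m) := by
  conv_lhs => rw [f.as_sum]
  rw [map_sum, Polynomial.finsetSum_coeff, Finset.sum_filter]
  refine Finset.sum_congr rfl fun m _ => ?_
  rw [toPoly_monomial, Polynomial.coeff_C_mul, Polynomial.coeff_X_pow]
  simp [eq_comm]

lemma eval_toPoly (k : Fin n) (f : MvPolynomial (Fin n) K) : (toPoly k f).eval (X k) = f := by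
  have : ((Polynomial.aeval (X k : MvPolynomial (Fin n) K)).restrictScalars K).comp
      (toPoly (K := K) k) = AlgHom.id K _ := by
    apply MvPolynomial.algHom_ext
    intro i
    by_cases h : i = k <;> simp [toPoly, h]
  simpa using DFunLike.congr_fun this f

lemma toPoly_injective (k : Fin n) : Function.Injective (toPoly (K := K) k) := fun f g h => by
  rw [← eval_toPoly k f, h, eval_toPoly]

lemma natDegree_toPoly (k : Fin n) (f : MvPolynomial (Fin n) K) :
    (toPoly k f).natDegree = f.degreeOf k := by
  apply le_antisymm
  · rw [Polynomial.natDegree_le_iff_coeff_eq_zero]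
    intro N hN
    ext e
    rw [coeff_toPoly_coeff, coeff_zero]
    split_ifs with h
    · by_contra hc
      have := le_degreeOf_of_mem_support k (mem_support_iff.2 hc)
      simp at this
      omega
    · rfl
  · rw [degreeOf_le_iff]
    intro m hm
    apply Polynomial.le_natDegree_of_ne_zero
    intro hc
    have := coeff_toPoly_coeff k f (m k) (m.erase k)
    rw [hc, coeff_zero, if_pos (by simp), Finsupp.erase_add_single] at this
    exact (mem_support_iff.1 hm) this.symm

lemma leadingCoeff_toPoly (k : Fin n) (f : MvPolynomial (Fin n) K) :
    (toPoly k f).leadingCoeff = leadCoeffIn k f := by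
  rw [Polynomial.leadingCoeff, natDegree_toPoly, coeff_toPoly, leadCoeffIn]

lemma map_aeval_toPoly (k : Fin n) (x : Fin n → AlgebraicClosure K)
    (f : MvPolynomial (Fin n) K) :
    (toPoly k f).map (aeval x : MvPolynomial (Fin n) K →ₐ[K] _).toRingHom = specialize k x f := by
  have : ((Polynomial.mapAlgHom (aeval x : MvPolynomial (Fin n) K →ₐ[K] AlgebraicClosure K))).comp
      (toPoly (K := K) k) =
      aeval (fun i => if i = k then Polynomial.X else Polynomial.C (x i)) := by
    apply MvPolynomial.algHom_ext
    intro i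
    by_cases h : i = k <;> simp [toPoly, h]
  simpa using! DFunLike.congr_fun this f

lemma degreeOf_coeff_toPoly_le (k j : Fin n) (f : MvPolynomial (Fin n) K) (i : ℕ) :
    ((toPoly k f).coeff i).degreeOf j ≤ f.degreeOf j := by
  rw [degreeOf_le_iff]
  intro e he
  rw [mem_support_iff, coeff_toPoly_coeff] at he
  split_ifs at he with h
  · exact le_trans (by simp) (le_degreeOf_of_mem_support j (mem_support_iff.2 he))
  · exact absurd rfl he

lemma degreeOf_coeff_toPoly_self (k : Fin n) (f : MvPolynomial (Fin n) K) (i : ℕ) :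
    ((toPoly k f).coeff i).degreeOf k = 0 := by
  rw [← Nat.le_zero, degreeOf_le_iff]
  intro e he
  rw [mem_support_iff, coeff_toPoly_coeff] at he
  split_ifs at he with h
  · exact h.le
  · exact absurd rfl he

lemma toPoly_of_notMem_vars {k : Fin n} {f : MvPolynomial (Fin n) K} (h : k ∉ f.vars) :
    toPoly k f = Polynomial.C f := by
  have h0 : (toPoly k f).natDegree = 0 := by
    rw [natDegree_toPoly]
    by_contra hc
    exact h (mem_vars_iff_degreeOf_ne_zero.2 hc)
  rw [Polynomial.eq_C_of_natDegree_eq_zero h0]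
  congr 1
  conv_rhs => rw [← eval_toPoly k f]
  rw [Polynomial.eq_C_of_natDegree_eq_zero h0]
  simp

/-! ### Main variables, initials and supports -/

lemma IsMainVar.unique {f : MvPolynomial (Fin n) K} {j k : Fin n} (hj : IsMainVar f j)
    (hk : IsMainVar f k) : j = k :=
  le_antisymm (hj.2 _ hk.1) (hk.2 _ hj.1)

lemma IsMainVar.initial_eq {f : MvPolynomial (Fin n) K} {k : Fin n} (h : IsMainVar f k) :
    initial f = (toPoly k f).leadingCoeff := by
  have hne : f.vars.Nonempty := ⟨k, h.1⟩
  have : f.vars.min' hne = k :=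
    IsMainVar.unique (f := f) ⟨Finset.min'_mem _ _, fun _ hi => Finset.min'_le _ _ hi⟩ h
  rw [initial, dif_pos hne, this, leadingCoeff_toPoly]

lemma IsMainVar.degreeOf_pos {f : MvPolynomial (Fin n) K} {k : Fin n} (h : IsMainVar f k) :
    0 < f.degreeOf k :=
  Nat.pos_of_ne_zero (mem_vars_iff_degreeOf_ne_zero.1 h.1)

lemma IsMainVar.ne_zero {f : MvPolynomial (Fin n) K} {k : Fin n} (h : IsMainVar f k) : f ≠ 0 := by
  rintro rfl
  simpa using h.1

lemma exists_isMainVar {f : MvPolynomial (Fin n) K} (h : f.vars.Nonempty) : ∃ k, IsMainVar f k :=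
  ⟨f.vars.min' h, Finset.min'_mem _ _, fun _ hi => Finset.min'_le _ _ hi⟩

lemma isMainVar_C_mul {f : MvPolynomial (Fin n) K} {c : K} (hc : c ≠ 0) {k : Fin n} :
    IsMainVar (C c * f) k ↔ IsMainVar f k := by
  simp only [IsMainVar, vars_C_mul c hc]

lemma aeval_congr_of_vars {f : MvPolynomial (Fin n) K} {x y : Fin n → AlgebraicClosure K}
    (h : ∀ i ∈ f.vars, x i = y i) : aeval x f = aeval y f := by
  simp only [aeval_def, ← coe_eval₂Hom]
  exact eval₂Hom_congr' rfl (fun i hi _ => h i hi) rfl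

end

/-! ### Pseudo-division -/

/-- Pseudo-division of univariate polynomials over a commutative ring. If the coefficients of the
dividend lie in an additive subgroup that is stable under multiplication by the coefficients of
the divisor, then so do those of the remainder. -/
lemma exists_pseudoDivision {R : Type*} [CommRing R] {b : Polynomial R} (hb : 0 < b.natDegree)
    {M : AddSubgroup R} (hM : ∀ c ∈ M, ∀ i, b.coeff i * c ∈ M) (m : ℕ) :
    ∀ a : Polynomial R, (∀ i, a.coeff i ∈ M) → a.natDegree < b.natDegree + m →
      ∃ q r : Polynomial R, Polynomial.C b.leadingCoeff ^ m * a = q * b + r ∧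
        r.natDegree < b.natDegree ∧ ∀ i, r.coeff i ∈ M := by
  induction m with
  | zero => exact fun a ha hd => ⟨0, a, by simp, hd, ha⟩
  | succ m ih =>
    intro a ha hd
    -- one step: cancel the coefficient of `a` of degree `b.natDegree + m`, which may be zero
    set α := a.coeff (b.natDegree + m) with hα
    have hcoeff : ∀ i, (Polynomial.C α * Polynomial.X ^ m * b).coeff i =
        if m ≤ i then b.coeff (i - m) * α else 0 := by
      intro i
      rw [mul_assoc, Polynomial.coeff_C_mul, Polynomial.coeff_X_pow_mul']
      split_ifs <;> ring
    obtain ⟨q, r, h1, h2, h3⟩ := ih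
      (Polynomial.C b.leadingCoeff * a - Polynomial.C α * Polynomial.X ^ m * b) (by
        intro i
        rw [Polynomial.coeff_sub, Polynomial.coeff_C_mul, hcoeff]
        refine M.sub_mem (hM _ (ha i) _) ?_
        split_ifs
        · exact hM _ (ha _) _
        · exact M.zero_mem) (by
        refine lt_of_le_of_lt (b := b.natDegree + m - 1) ?_ (by omega)
        rw [Polynomial.natDegree_le_iff_coeff_eq_zero]
        intro N hN
        rw [Polynomial.coeff_sub, Polynomial.coeff_C_mul, hcoeff, if_pos (by omega)]
        rcases Nat.lt_or_ge (b.natDegree + m) N with h | h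
        · rw [Polynomial.coeff_eq_zero_of_natDegree_lt (p := a) (by omega),
            Polynomial.coeff_eq_zero_of_natDegree_lt (p := b) (by omega)]
          simp
        · have : N = b.natDegree + m := by omega
          subst this
          rw [hα, show b.natDegree + m - m = b.natDegree by omega, Polynomial.coeff_natDegree,
            sub_self])
    refine ⟨q + Polynomial.C b.leadingCoeff ^ m * (Polynomial.C α * Polynomial.X ^ m), r, ?_,
      h2, h3⟩
    linear_combination h1

section

variable {K : Type*} [Field K] {n : ℕ}

/-- Pseudo-remainders exist; taking one does not raise the degree in the larger variables. -/
lemma exists_isPseudoRem {k : Fin n} {g : MvPolynomial (Fin n) K} (hg : IsMainVar g k)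
    (f : MvPolynomial (Fin n) K) :
    ∃ r, IsPseudoRem k f g r ∧ r.degreeOf k < g.degreeOf k ∧
      ∀ j < k, r.degreeOf j ≤ f.degreeOf j := by
  rcases Nat.lt_or_ge (f.degreeOf k) (g.degreeOf k) with hlt | hge
  · exact ⟨f, Or.inl ⟨hlt, rfl⟩, hlt, fun _ _ => le_rfl⟩
  -- the coefficients stay free of `x_k` and of bounded degree in the larger variables
  let M : AddSubgroup (MvPolynomial (Fin n) K) :=
    { carrier := {c | c.degreeOf k ≤ 0 ∧ ∀ j < k, c.degreeOf j ≤ f.degreeOf j}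
      zero_mem' := by simp
      add_mem' := fun {a b} ha hb =>
        ⟨(degreeOf_add_le _ _ _).trans (max_le ha.1 hb.1),
          fun j hj => (degreeOf_add_le _ _ _).trans (max_le (ha.2 j hj) (hb.2 j hj))⟩
      neg_mem' := fun {a} ha => by
        have h (j : Fin n) : (-a).degreeOf j ≤ a.degreeOf j := by
          simp
        exact ⟨(h k).trans ha.1, fun j hj => (h j).trans (ha.2 j hj)⟩ }
  have hb0 : ∀ j ≤ k, ∀ i, ((toPoly k g).coeff i).degreeOf j = 0 := by
    intro j hj i
    rcases eq_or_lt_of_le hj with rfl | hj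
    · exact degreeOf_coeff_toPoly_self _ _ _
    · refine Nat.le_zero.1 ((degreeOf_coeff_toPoly_le k j g i).trans ?_)
      by_contra hc
      exact absurd (hg.2 j (mem_vars_iff_degreeOf_ne_zero.2 (by omega))) (not_le.2 hj)
  obtain ⟨q, r, h1, h2, h3⟩ := exists_pseudoDivision (b := toPoly k g)
    (by rw [natDegree_toPoly]; exact hg.degreeOf_pos) (M := M) (by
      intro c hc i
      refine ⟨(degreeOf_mul_le _ _ _).trans ?_, fun j hj => (degreeOf_mul_le _ _ _).trans ?_⟩
      · rw [hb0 k le_rfl, zero_add]; exact hc.1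
      · rw [hb0 j hj.le, zero_add]; exact hc.2 j hj)
    (f.degreeOf k - g.degreeOf k + 1) (toPoly k f)
    (fun i => ⟨(degreeOf_coeff_toPoly_self _ _ _).le, fun j _ => degreeOf_coeff_toPoly_le _ _ _ _⟩)
    (by rw [natDegree_toPoly, natDegree_toPoly]; omega)
  have hterm : ∀ (j : Fin n) (D : ℕ),
      (∀ i ≤ r.natDegree, (r.coeff i * X k ^ i).degreeOf j ≤ D) →
      (r.eval (X k)).degreeOf j ≤ D := by
    intro j D h
    rw [Polynomial.eval_eq_sum_range]
    refine (degreeOf_sum_le _ _ _).trans (Finset.sup_le fun i hi => h i ?_)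
    exact Nat.lt_succ_iff.1 (Finset.mem_range.1 hi)
  have hk : (r.eval (X k)).degreeOf k < g.degreeOf k := by
    refine lt_of_le_of_lt (hterm k r.natDegree fun i hi => ?_) (by rwa [← natDegree_toPoly])
    refine (degreeOf_mul_le _ _ _).trans ?_
    rw [degreeOf_X_self_pow]
    have := (h3 i).1
    omega
  refine ⟨r.eval (X k), Or.inr ⟨hge, hk, q.eval (X k), ?_⟩, hk, ?_⟩
  · have := congrArg (Polynomial.eval (X k)) h1
    simpa [eval_toPoly, hg.initial_eq] using this
  · intro j hj
    refine hterm j _ fun i _ => (degreeOf_mul_le _ _ _).trans ?_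
    rw [degreeOf_X_pow_of_ne _ hj.ne, add_zero]
    exact (h3 i).2 j hj

/-- Successive pseudo-division by a triangular set: the result is reduced with respect to each
element of the set. -/
lemma exists_isPseudoRemSet {T : Finset (MvPolynomial (Fin n) K)} (hT : IsTriangularSet T)
    (f : MvPolynomial (Fin n) K) :
    ∃ r, IsPseudoRemSet T f r ∧ ∀ k, ∀ t ∈ T, IsMainVar t k → r.degreeOf k < t.degreeOf k := by
  have hstep : ∀ (k : Fin n) (s : MvPolynomial (Fin n) K), ∃ s',
      (∀ t ∈ T, IsMainVar t k → IsPseudoRem k s t s') ∧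
      ((∀ t ∈ T, ¬ IsMainVar t k) → s' = s) ∧
      (∀ t ∈ T, IsMainVar t k → s'.degreeOf k < t.degreeOf k) ∧
      ∀ j < k, s'.degreeOf j ≤ s.degreeOf j := by
    intro k s
    by_cases h : ∃ t ∈ T, IsMainVar t k
    · obtain ⟨t, ht, htk⟩ := h
      obtain ⟨r, h1, h2, h3⟩ := exists_isPseudoRem htk s
      refine ⟨r, ?_, fun h => absurd htk (h t ht), ?_, h3⟩
      · intro t' ht' htk'
        rwa [hT.2 t' ht' t ht k htk' htk]
      · intro t' ht' htk'
        rwa [hT.2 t' ht' t ht k htk' htk]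
    · push Not at h
      exact ⟨s, fun t ht htk => absurd htk (h t ht), fun _ => rfl,
        fun t ht htk => absurd htk (h t ht), fun _ _ => le_rfl⟩
  choose step h1 h2 h3 h4 using hstep
  let s : Fin (n + 1) → MvPolynomial (Fin n) K :=
    Fin.induction (motive := fun _ => MvPolynomial (Fin n) K) f step
  have hs : ∀ k : Fin n, s k.succ = step k (s k.castSucc) := fun k => by simp [s]
  have hred : ∀ i : Fin (n + 1), ∀ k : Fin n, k.castSucc < i →
      ∀ t ∈ T, IsMainVar t k → (s i).degreeOf k < t.degreeOf k := by
    intro i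
    induction i using Fin.induction with
    | zero => intro k hk; exact absurd hk (Fin.not_lt_zero _)
    | succ i ih =>
      intro k hk t ht htk
      rw [hs]
      rcases eq_or_lt_of_le (Fin.castSucc_lt_succ_iff.1 hk) with rfl | hlt
      · exact h3 _ _ t ht htk
      · exact (h4 _ _ k hlt).trans_lt (ih k (by simpa using hlt) t ht htk)
  refine ⟨s (Fin.last n), ⟨s, by simp [s], rfl, fun k => ⟨?_, ?_⟩⟩, fun k t ht htk => ?_⟩
  · rw [hs]; exact h1 k _
  · rw [hs]; exact h2 k _
  · exact hred _ k (Fin.castSucc_lt_last k) t ht htk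

/-! ### The ideal of a polynomial system -/

/-- The ideal `⟨T⟩ : u^∞` of a polynomial system `(T, U)`, where `u` is the product of `U`. -/
def systemIdeal (S : PolySystem K n) : Ideal (MvPolynomial (Fin n) K) where
  carrier := {f | ∃ N : ℕ, (∏ u ∈ S.ineqs, u) ^ N * f ∈
    Ideal.span (S.eqs : Set (MvPolynomial (Fin n) K))}
  zero_mem' := ⟨0, by simp⟩
  add_mem' := by
    rintro a b ⟨N, hN⟩ ⟨M, hM⟩
    refine ⟨N + M, ?_⟩
    have : (∏ u ∈ S.ineqs, u) ^ (N + M) * (a + b) =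
        (∏ u ∈ S.ineqs, u) ^ M * ((∏ u ∈ S.ineqs, u) ^ N * a) +
        (∏ u ∈ S.ineqs, u) ^ N * ((∏ u ∈ S.ineqs, u) ^ M * b) := by ring
    rw [this]
    exact Ideal.add_mem _ (Ideal.mul_mem_left _ _ hN) (Ideal.mul_mem_left _ _ hM)
  smul_mem' := by
    rintro c a ⟨N, hN⟩
    refine ⟨N, ?_⟩
    rw [smul_eq_mul, mul_left_comm]
    exact Ideal.mul_mem_left _ _ hN

lemma mem_systemIdeal_of_mem_span {S : PolySystem K n} {f : MvPolynomial (Fin n) K}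
    (h : f ∈ Ideal.span (S.eqs : Set (MvPolynomial (Fin n) K))) : f ∈ systemIdeal S :=
  ⟨0, by simpa using h⟩

lemma aeval_eq_zero_of_mem_span {T : Finset (MvPolynomial (Fin n) K)}
    {x : Fin n → AlgebraicClosure K} (hx : ∀ f ∈ T, aeval x f = 0) {f : MvPolynomial (Fin n) K}
    (hf : f ∈ Ideal.span (T : Set (MvPolynomial (Fin n) K))) : aeval x f = 0 := by
  have : Ideal.span (T : Set (MvPolynomial (Fin n) K)) ≤
      RingHom.ker (aeval x : MvPolynomial (Fin n) K →ₐ[K] AlgebraicClosure K) :=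
    Ideal.span_le.2 fun f hf => hx f hf
  exact this hf

/-- The Nullstellensatz, for an ideal over `K` and points over the algebraic closure. -/
lemma exists_pow_mem_of_vanishing {I : Ideal (MvPolynomial (Fin n) K)}
    {f : MvPolynomial (Fin n) K}
    (h : ∀ x : Fin n → AlgebraicClosure K, (∀ p ∈ I, aeval x p = 0) → aeval x f = 0) :
    ∃ N : ℕ, f ^ N ∈ I := by
  have : f ∈ I.radical := by
    rw [← vanishingIdeal_zeroLocus_eq_radical (K := AlgebraicClosure K)]
    exact fun x hx => h x hx
  exact this

/-- By the Nullstellensatz, a polynomial that vanishes nowhere on the zeros of a system is a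
nonzerodivisor modulo the ideal of the system. -/
lemma mem_systemIdeal_of_mul_mem {S : PolySystem K n} {g f : MvPolynomial (Fin n) K}
    (hg : ∀ x ∈ S.zeros, aeval x g ≠ 0) (h : g * f ∈ systemIdeal S) : f ∈ systemIdeal S := by
  obtain ⟨N, hN⟩ := h
  obtain ⟨M, hM⟩ := exists_pow_mem_of_vanishing
    (I := Ideal.span (S.eqs : Set (MvPolynomial (Fin n) K)) ⊔ Ideal.span {g})
    (f := ∏ u ∈ S.ineqs, u) (by
      intro x hx
      by_contra hc
      rw [map_prod, ← ne_eq, Finset.prod_ne_zero_iff] at hc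
      exact hg x ⟨fun p hp => hx p (Ideal.mem_sup_left (Ideal.subset_span hp)), hc⟩
        (hx g (Ideal.mem_sup_right (Ideal.mem_span_singleton_self g))))
  obtain ⟨a, ha, b, hb, hab⟩ := Submodule.mem_sup.1 hM
  obtain ⟨q, rfl⟩ := Ideal.mem_span_singleton'.1 hb
  refine ⟨N + M, ?_⟩
  have : (∏ u ∈ S.ineqs, u) ^ (N + M) * f =
      ((∏ u ∈ S.ineqs, u) ^ N * f) * a + q * ((∏ u ∈ S.ineqs, u) ^ N * (g * f)) := by
    rw [pow_add, ← hab]; ring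
  rw [this]
  exact Ideal.add_mem _ (Ideal.mul_mem_left _ _ ha) (Ideal.mul_mem_left _ _ hN)

lemma exists_pow_mem_systemIdeal {S : PolySystem K n} {f : MvPolynomial (Fin n) K}
    (hf : ∀ x ∈ S.zeros, aeval x f = 0) : ∃ N : ℕ, f ^ N ∈ systemIdeal S := by
  -- the product of `f` and the inequations vanishes on the variety of the equations
  obtain ⟨N, hN⟩ := exists_pow_mem_of_vanishing
    (I := Ideal.span (S.eqs : Set (MvPolynomial (Fin n) K)))
    (f := (∏ u ∈ S.ineqs, u) * f) (by
      intro x hx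
      by_contra hc
      rw [map_mul, ← ne_eq, mul_ne_zero_iff, map_prod, Finset.prod_ne_zero_iff] at hc
      exact hc.2 (hf x ⟨fun p hp => hx p (Ideal.subset_span hp), hc.1⟩))
  exact ⟨N, N, by rwa [← mul_pow]⟩

/-! ### Regular systems give regular chains -/

lemma elim_zero (S : PolySystem K n) : S.elim 0 = S := by
  ext f <;> simp [PolySystem.elim]

lemma zeros_elim_mono (S : PolySystem K n) {p q : ℕ} (h : p ≤ q) :
    (S.elim p).zeros ⊆ (S.elim q).zeros := by
  have hs : supported K {i : Fin n | q ≤ (i : ℕ)} ≤ supported K {i : Fin n | p ≤ (i : ℕ)} :=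
    supported_mono fun i (hi : q ≤ (i : ℕ)) => h.trans hi
  rintro x ⟨h1, h2⟩
  simp only [PolySystem.elim, Finset.mem_filter] at h1 h2
  refine ⟨fun f hf => ?_, fun f hf => ?_⟩ <;>
    simp only [PolySystem.elim, Finset.mem_filter] at hf
  · exact h1 f ⟨hf.1, hs hf.2⟩
  · exact h2 f ⟨hf.1, hs hf.2⟩

lemma zeros_subset_zeros_elim (S : PolySystem K n) (p : ℕ) : S.zeros ⊆ (S.elim p).zeros := by
  have := zeros_elim_mono S (Nat.zero_le p)
  rwa [elim_zero] at this

lemma mem_supported_succ_or_isMainVar {k : Fin n} {f : MvPolynomial (Fin n) K}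
    (h : f ∈ supported K {i : Fin n | (k : ℕ) ≤ i}) :
    f ∈ supported K {i : Fin n | (k : ℕ) + 1 ≤ i} ∨ IsMainVar f k := by
  rw [mem_supported] at h
  by_cases hk : k ∈ f.vars
  · exact Or.inr ⟨hk, fun i hi => h hi⟩
  · left
    rw [mem_supported]
    intro i hi
    have h1 : (k : ℕ) ≤ i := h hi
    have h2 : (k : ℕ) ≠ i := by
      intro hc
      exact hk (Fin.ext hc ▸ hi)
    change (k : ℕ) + 1 ≤ i
    omega

lemma IsMainVar.mem_supported {k : Fin n} {f : MvPolynomial (Fin n) K} (h : IsMainVar f k) :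
    f ∈ supported K {i : Fin n | (k : ℕ) ≤ i} :=
  MvPolynomial.mem_supported.2 fun i hi => h.2 i hi

lemma IsMainVar.notMem_supported {k : Fin n} {f : MvPolynomial (Fin n) K} (h : IsMainVar f k)
    {p : ℕ} (hp : (k : ℕ) < p) : f ∉ supported K {i : Fin n | p ≤ (i : ℕ)} := fun hc =>
  absurd (MvPolynomial.mem_supported.1 hc h.1) (not_le.2 hp)

lemma IsRegularSystem.initial_aeval_ne_zero {S : PolySystem K n} (hS : IsRegularSystem S)
    {t : MvPolynomial (Fin n) K} (ht : t ∈ S.eqs) {x : Fin n → AlgebraicClosure K}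
    (hx : x ∈ S.zeros) : aeval x (initial t) ≠ 0 := by
  obtain ⟨k, hk⟩ := hS.triangular.1 t ht
  exact hS.initial_ne_zero k t (Or.inl ht) hk x (zeros_subset_zeros_elim S _ hx)

/-- The ideals of the successive elimination systems of a regular system: the coefficients, with
respect to `x_k`, of an element of the `k`-th ideal that is reduced in `x_k` belong to the next
one. Modulo the next ideal, the leading coefficients in `x_k` are nonzerodivisors, so that no
cancellation takes place in the top degrees. -/
lemma coeff_mem_systemIdeal_elim {S : PolySystem K n} (hS : IsRegularSystem S) {k : Fin n}
    {r : MvPolynomial (Fin n) K} (hr : r ∈ systemIdeal (S.elim k))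
    (hred : ∀ t ∈ S.eqs, IsMainVar t k → r.degreeOf k < t.degreeOf k) (i : ℕ) :
    (toPoly k r).coeff i ∈ systemIdeal (S.elim ((k : ℕ) + 1)) := by
  set J := systemIdeal (S.elim ((k : ℕ) + 1)) with hJ
  by_cases htop : J = ⊤
  · rw [htop]; trivial
  have : Nontrivial (MvPolynomial (Fin n) K ⧸ J) := Ideal.Quotient.nontrivial_iff.2 htop
  let ψ : MvPolynomial (Fin n) K →+* Polynomial (MvPolynomial (Fin n) K ⧸ J) :=
    (Polynomial.mapRingHom (Ideal.Quotient.mk J)).comp (toPoly k).toRingHom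
  have hψ (f : MvPolynomial (Fin n) K) : ψ f = (toPoly k f).map (Ideal.Quotient.mk J) := rfl
  suffices h : ψ r = 0 by
    have := congrArg (fun p => Polynomial.coeff p i) h
    simpa [hψ, Polynomial.coeff_map, Ideal.Quotient.eq_zero_iff_mem] using this
  have hreg : ∀ a : MvPolynomial (Fin n) K, (∀ x ∈ (S.elim ((k : ℕ) + 1)).zeros, aeval x a ≠ 0) →
      Ideal.Quotient.mk J a ∈ nonZeroDivisors (MvPolynomial (Fin n) K ⧸ J) := by
    intro a ha
    rw [mem_nonZeroDivisors_iff_right]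
    intro b hb
    obtain ⟨b, rfl⟩ := Ideal.Quotient.mk_surjective b
    rw [← map_mul, Ideal.Quotient.eq_zero_iff_mem, mul_comm] at hb
    exact Ideal.Quotient.eq_zero_iff_mem.2 (mem_systemIdeal_of_mul_mem ha hb)
  have hC : ∀ f ∈ supported K {i : Fin n | (k : ℕ) + 1 ≤ i},
      ψ f = Polynomial.C (Ideal.Quotient.mk J f) := by
    intro f hf
    rw [hψ, toPoly_of_notMem_vars, Polynomial.map_C]
    intro hk
    have : (k : ℕ) + 1 ≤ k := mem_supported.1 hf hk
    omega
  have hlead : ∀ f, f ∈ S.eqs ∨ f ∈ S.ineqs → IsMainVar f k →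
      (ψ f).leadingCoeff ∈ nonZeroDivisors (MvPolynomial (Fin n) K ⧸ J) ∧
      (ψ f).natDegree = f.degreeOf k := by
    intro f hf hfk
    have h1 := hreg _ (hS.initial_ne_zero k f hf hfk)
    have h2 := nonZeroDivisors.ne_zero h1
    rw [hfk.initial_eq] at h1 h2
    rw [hψ, Polynomial.leadingCoeff_map_of_leadingCoeff_ne_zero _ h2,
      Polynomial.natDegree_map_of_leadingCoeff_ne_zero _ h2, natDegree_toPoly]
    exact ⟨h1, rfl⟩
  have heqs : ∀ f ∈ (S.elim ((k : ℕ) + 1)).eqs, ψ f = 0 := by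
    intro f hf
    have : f ∈ J := mem_systemIdeal_of_mem_span (Ideal.subset_span hf)
    simp only [PolySystem.elim, Finset.mem_filter] at hf
    rw [hC f hf.2, Ideal.Quotient.eq_zero_iff_mem.2 this, Polynomial.C_0]
  have hineq : ∀ f ∈ S.ineqs, f ∈ supported K {i : Fin n | (k : ℕ) + 1 ≤ i} →
      Ideal.Quotient.mk J f ∈ nonZeroDivisors (MvPolynomial (Fin n) K ⧸ J) := by
    intro f hf hfs
    refine hreg f fun x hx => hx.2 f ?_
    simp only [PolySystem.elim, Finset.mem_filter]
    exact ⟨hf, hfs⟩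
  -- the product of the inequations remains a nonzerodivisor, so it may be cancelled
  have hu : ψ (∏ u ∈ (S.elim k).ineqs, u) ∈
      nonZeroDivisors (Polynomial (MvPolynomial (Fin n) K ⧸ J)) := by
    rw [map_prod]
    refine Submonoid.prod_mem
      (M := Polynomial (MvPolynomial (Fin n) K ⧸ J)) _ fun f hf => ?_
    simp only [PolySystem.elim, Finset.mem_filter] at hf
    apply Polynomial.mem_nonZeroDivisors_of_leadingCoeff
    rcases mem_supported_succ_or_isMainVar hf.2 with h | h
    · rw [hC f h, Polynomial.leadingCoeff_C]
      exact hineq f hf.1 h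
    · exact (hlead f (Or.inr hf.1) h).1
  obtain ⟨N, hN⟩ := hr
  -- it is enough to see that the combination of the equations dies under `ψ`
  suffices h : ψ ((∏ u ∈ (S.elim k).ineqs, u) ^ N * r) = 0 by
    rw [map_mul, map_pow] at h
    exact (mem_nonZeroDivisors_iff.1 (pow_mem hu N)).1 _ h
  by_cases ht : ∃ t ∈ S.eqs, IsMainVar t k
  · obtain ⟨t, ht, htk⟩ := ht
    have hsp : Ideal.span ((S.elim k).eqs : Set (MvPolynomial (Fin n) K)) ≤
        RingHom.ker ψ ⊔ Ideal.span {t} := by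
      rw [Ideal.span_le]
      intro f hf
      simp only [PolySystem.elim, Finset.coe_filter, Set.mem_ofPred_eq] at hf
      rcases mem_supported_succ_or_isMainVar hf.2 with h | h
      · refine Ideal.mem_sup_left (heqs f ?_)
        simp only [PolySystem.elim, Finset.mem_filter]
        exact ⟨hf.1, h⟩
      · rw [hS.triangular.2 f hf.1 t ht k h htk]
        exact Ideal.mem_sup_right (Ideal.mem_span_singleton_self t)
    obtain ⟨a, ha, b, hb, hab⟩ := Submodule.mem_sup.1 (hsp hN)
    obtain ⟨q, rfl⟩ := Ideal.mem_span_singleton'.1 hb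
    have h1 : ψ ((∏ u ∈ (S.elim k).ineqs, u) ^ N * r) = ψ q * ψ t := by
      rw [← hab, map_add, RingHom.mem_ker.1 ha, zero_add, map_mul]
    obtain ⟨hl, hd⟩ := hlead t (Or.inl ht) htk
    have h2 : ψ (∏ u ∈ (S.elim k).ineqs, u) =
        Polynomial.C (Ideal.Quotient.mk J (∏ u ∈ (S.elim k).ineqs, u)) := by
      apply hC
      refine Subalgebra.prod_mem _ fun f hf => ?_
      simp only [PolySystem.elim, Finset.mem_filter] at hf
      rcases mem_supported_succ_or_isMainVar hf.2 with h | h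
      · exact h
      · exact absurd h (((hS.eqs_or_ineqs k).resolve_left fun h => h t ht htk) f hf.1)
    -- a nonzero multiple of `ψ t` has degree at least that of `t`, but `r` has smaller degree
    rw [h1]
    by_contra hne
    have hq : ψ q ≠ 0 := fun hq => hne (by rw [hq, zero_mul])
    have h3 : (ψ q * ψ t).natDegree = (ψ q).natDegree + (ψ t).natDegree := by
      apply Polynomial.natDegree_mul'
      intro hc
      exact hq (Polynomial.leadingCoeff_eq_zero.1 ((mem_nonZeroDivisors_iff_right.1 hl) _ hc))
    have h4 : (ψ q * ψ t).natDegree ≤ r.degreeOf k := by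
      rw [← h1, map_mul, map_pow, h2, ← Polynomial.C_pow]
      refine (Polynomial.natDegree_C_mul_le _ _).trans ?_
      rw [hψ, ← natDegree_toPoly]
      exact Polynomial.natDegree_map_le
    have := hred t ht htk
    omega
  · have hsp : Ideal.span ((S.elim k).eqs : Set (MvPolynomial (Fin n) K)) ≤ RingHom.ker ψ := by
      rw [Ideal.span_le]
      intro f hf
      simp only [PolySystem.elim, Finset.coe_filter, Set.mem_ofPred_eq] at hf
      rcases mem_supported_succ_or_isMainVar hf.2 with h | h
      · refine heqs f ?_
        simp only [PolySystem.elim, Finset.mem_filter]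
        exact ⟨hf.1, h⟩
      · exact absurd ⟨f, hf.1, h⟩ ht
    exact hsp hN

/-- Only zero is reduced with respect to a regular system and in its ideal. -/
lemma eq_zero_of_reduced {S : PolySystem K n} (hS : IsRegularSystem S) {k : ℕ} (hk : k ≤ n) :
    ∀ r ∈ systemIdeal (S.elim k), (∀ j : Fin n, k ≤ (j : ℕ) → ∀ t ∈ S.eqs, IsMainVar t j →
      r.degreeOf j < t.degreeOf j) → r = 0 := by
  induction hk using Nat.decreasingInduction with
  | self =>
    rintro r ⟨N, hN⟩ -
    have h0 : (S.elim n).eqs = ∅ := by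
      rw [Finset.eq_empty_iff_forall_notMem]
      intro f hf
      simp only [PolySystem.elim, Finset.mem_filter] at hf
      obtain ⟨j, hj⟩ := hS.triangular.1 f hf.1
      exact hj.notMem_supported j.isLt hf.2
    rw [h0, Finset.coe_empty, Ideal.span_empty, Submodule.mem_bot, mul_eq_zero] at hN
    refine hN.resolve_left (pow_ne_zero _ (Finset.prod_ne_zero_iff.2 fun u hu => ?_))
    simp only [PolySystem.elim, Finset.mem_filter] at hu
    exact hS.ineqs_ne_zero u hu.1
  | of_succ k hk ih =>
    intro r hr hred
    apply toPoly_injective (⟨k, hk⟩ : Fin n)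
    rw [map_zero]
    ext1 i
    rw [Polynomial.coeff_zero]
    refine ih _ (coeff_mem_systemIdeal_elim hS (k := ⟨k, hk⟩) hr (hred ⟨k, hk⟩ le_rfl) i) ?_
    intro j hj t ht htj
    exact (degreeOf_coeff_toPoly_le _ _ _ _).trans_lt (hred j (by omega) t ht htj)

/-- The multipliers of the successive pseudo-divisions are powers of initials, so they divide a
power of the product of the initials. -/
lemma IsPseudoRemSet.memSat {T : Finset (MvPolynomial (Fin n) K)} {f : MvPolynomial (Fin n) K}
    (h : IsPseudoRemSet T f 0) : MemSat T f := by
  obtain ⟨s, rfl, hlast, hs⟩ := h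
  have : ∀ i : Fin (n + 1), MemSat T (s i) := by
    intro i
    induction i using Fin.reverseInduction with
    | last => rw [hlast]; exact ⟨0, by simp⟩
    | cast k ih =>
      obtain ⟨h1, h2⟩ := hs k
      by_cases ht : ∃ t ∈ T, IsMainVar t k
      · obtain ⟨t, ht, htk⟩ := ht
        rcases h1 t ht htk with ⟨-, h⟩ | ⟨-, -, q, h⟩
        · rwa [← h]
        · obtain ⟨N, hN⟩ := ih
          set e := (s k.castSucc).degreeOf k - t.degreeOf k + 1
          obtain ⟨c, hc⟩ : initial t ∣ initialProd T := Finset.dvd_prod_of_mem _ ht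
          refine ⟨N + e, ?_⟩
          have : initialProd T ^ (N + e) * s k.castSucc =
              initialProd T ^ N * c ^ e * q * t + c ^ e * (initialProd T ^ N * s k.succ) := by
            have h' : c ^ e * (initial t ^ e * s k.castSucc) = c ^ e * (q * t + s k.succ) := by
              rw [h]
            have hp : initialProd T ^ e = initial t ^ e * c ^ e := by rw [hc, mul_pow]
            rw [pow_add, hp]
            linear_combination initialProd T ^ N * h'
          rw [this]
          exact Ideal.add_mem _ (Ideal.mul_mem_left _ _ (Ideal.subset_span ht))
            (Ideal.mul_mem_left _ _ hN)
      · rw [← h2 (by push Not at ht; exact ht)]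
        exact ih
  exact this 0

lemma isPseudoRemSet_zero_of_mem_systemIdeal {S : PolySystem K n} (hS : IsRegularSystem S)
    {f : MvPolynomial (Fin n) K} (hf : f ∈ systemIdeal S) : IsPseudoRemSet S.eqs f 0 := by
  obtain ⟨r, hr, hred⟩ := exists_isPseudoRemSet hS.triangular f
  suffices h : r ∈ systemIdeal S by
    have := eq_zero_of_reduced hS (Nat.zero_le n) r (by rwa [elim_zero]) fun j _ => hred j
    rwa [this] at hr
  obtain ⟨s, rfl, rfl, hs⟩ := hr
  have : ∀ i : Fin (n + 1), s i ∈ systemIdeal S := by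
    intro i
    induction i using Fin.induction with
    | zero => exact hf
    | succ k ih =>
      obtain ⟨h1, h2⟩ := hs k
      by_cases ht : ∃ t ∈ S.eqs, IsMainVar t k
      · obtain ⟨t, ht, htk⟩ := ht
        rcases h1 t ht htk with ⟨-, h⟩ | ⟨-, -, q, h⟩
        · rwa [h]
        · rw [← sub_eq_iff_eq_add'.2 h]
          exact Ideal.sub_mem _ (Ideal.mul_mem_left _ _ ih) (Ideal.mul_mem_left _ _
            (mem_systemIdeal_of_mem_span (Ideal.subset_span ht)))
      · rw [h2 (by push Not at ht; exact ht)]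
        exact ih
  exact this _

lemma IsRegularSystem.initialProd_aeval_ne_zero {S : PolySystem K n} (hS : IsRegularSystem S)
    {x : Fin n → AlgebraicClosure K} (hx : x ∈ S.zeros) : aeval x (initialProd S.eqs) ≠ 0 := by
  rw [initialProd, map_prod, Finset.prod_ne_zero_iff]
  exact fun t ht => hS.initial_aeval_ne_zero ht hx

/-- The equations of a regular system form a regular chain. -/
theorem IsRegularSystem.isRegularChain {S : PolySystem K n} (hS : IsRegularSystem S) :
    IsRegularChain S.eqs := by
  refine ⟨hS.triangular, fun f => ⟨?_, IsPseudoRemSet.memSat⟩⟩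
  rintro ⟨N, hN⟩
  refine isPseudoRemSet_zero_of_mem_systemIdeal hS
    (mem_systemIdeal_of_mul_mem (g := initialProd S.eqs ^ N) (fun _ hx => ?_)
      (mem_systemIdeal_of_mem_span hN))
  rw [map_pow]
  exact pow_ne_zero _ (hS.initialProd_aeval_ne_zero hx)

lemma IsRegularSystem.zeros_subset_quasiComponent {S : PolySystem K n} (hS : IsRegularSystem S) :
    S.zeros ⊆ quasiComponent S.eqs := fun _ hx =>
  ⟨hx.1, fun h => hS.initialProd_aeval_ne_zero hx (h _ (Finset.mem_singleton_self _))⟩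

/-- The zeros of a regular system are dense in the quasi-component of its equations: dropping the
inequations adds no zeros outside of the closure. -/
theorem IsRegularSystem.aeval_eq_zero_of_mem_quasiComponent {S : PolySystem K n}
    (hS : IsRegularSystem S) {f : MvPolynomial (Fin n) K} (hf : ∀ x ∈ S.zeros, aeval x f = 0)
    {x : Fin n → AlgebraicClosure K} (hx : x ∈ quasiComponent S.eqs) : aeval x f = 0 := by
  obtain ⟨M, hM⟩ := exists_pow_mem_systemIdeal hf
  obtain ⟨N, hN⟩ := (isPseudoRemSet_zero_of_mem_systemIdeal hS hM).memSat
  have h := aeval_eq_zero_of_mem_span hx.1 hN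
  rw [map_mul, map_pow, map_pow, mul_eq_zero] at h
  rcases h with h | h
  · refine absurd ?_ hx.2
    intro g hg
    rw [Finset.mem_singleton.1 hg]
    exact eq_zero_of_pow_eq_zero h
  · exact eq_zero_of_pow_eq_zero h

end

end

end ChordalNet

namespace ChordalNet

open Polynomial

noncomputable section

/-! ### Univariate systems over a field of characteristic zero -/

/-- The part of `g` prime to `h`, made squarefree. -/
lemma exists_squarefree_isCoprime {κ : Type*} [Field κ] {g : κ[X]} (hg : g ≠ 0) (h : κ[X]) :
    ∃ w : κ[X], ∃ N : ℕ, Squarefree w ∧ w ∣ g ∧ IsCoprime w h ∧ g ∣ (w * h) ^ N := by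
  classical
  obtain ⟨y, N, hy, hyg, hgy⟩ := exists_squarefree_dvd_pow_of_ne_zero hg
  obtain ⟨w, hw⟩ := EuclideanDomain.gcd_dvd_left y h
  have hwy : w ∣ y := ⟨_, by rw [mul_comm]; exact hw⟩
  refine ⟨w, N, hy.squarefree_of_dvd hwy, hwy.trans hyg, ?_, hgy.trans (pow_dvd_pow_of_dvd ?_ N)⟩
  · rw [← isRelPrime_iff_isCoprime]
    intro e hew heh
    have h1 : e ∣ EuclideanDomain.gcd y h := EuclideanDomain.dvd_gcd (hew.trans hwy) heh
    exact hy e (by rw [hw]; exact mul_dvd_mul h1 hew)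
  · conv_lhs => rw [hw, mul_comm]
    exact mul_dvd_mul_left _ (EuclideanDomain.gcd_dvd_right y h)

section generic

/-! ### Clearing denominators at a prime -/

variable {R : Type*} [CommRing R] {p : Ideal R} [p.IsPrime]

/-- Polynomials over the residue field of `p` are, up to a denominator outside of `p`, reductions of
polynomials over `R`. -/
lemma exists_map_eq_C_mul (z : p.ResidueField[X]) :
    ∃ c ∉ p, ∃ r : R[X], r.map (algebraMap R p.ResidueField) =
      C (algebraMap R p.ResidueField c) * z := by
  obtain ⟨b, hb, h⟩ := IsLocalization.integerNormalization_spec (nonZeroDivisors (R ⧸ p)) z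
  obtain ⟨c, rfl⟩ := Ideal.Quotient.mk_surjective b
  obtain ⟨r, hr⟩ := Polynomial.map_surjective _ (Ideal.Quotient.mk_surjective (I := p))
    (IsLocalization.integerNormalization (nonZeroDivisors (R ⧸ p)) z)
  refine ⟨c, fun hc => nonZeroDivisors.ne_zero hb (Ideal.Quotient.eq_zero_iff_mem.2 hc), r, ?_⟩
  have h1 : r.map (algebraMap R p.ResidueField) =
      (r.map (Ideal.Quotient.mk p)).map (algebraMap (R ⧸ p) p.ResidueField) := by
    rw [Polynomial.map_map]; rfl
  rw [h1, hr, h, Algebra.smul_def]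
  rfl

/-- An ideal membership over the residue field of `p` holds over `R` modulo `p`, up to a
denominator outside of `p`. -/
lemma exists_C_mul_mem {S : Set R[X]} {r : R[X]}
    (h : r.map (algebraMap R p.ResidueField) ∈
      Ideal.span ((fun f : R[X] => f.map (algebraMap R p.ResidueField)) '' S)) :
    ∃ c ∉ p, C c * r ∈ Ideal.span S ⊔ p.map (C : R →+* R[X]) := by
  suffices key : ∀ z ∈ Ideal.span ((fun f : R[X] => f.map (algebraMap R p.ResidueField)) '' S),
      ∃ c ∉ p, ∃ r ∈ Ideal.span S, r.map (algebraMap R p.ResidueField) =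
        C (algebraMap R p.ResidueField c) * z by
    obtain ⟨c, hc, r', hr', h'⟩ := key _ h
    refine ⟨c, hc, ?_⟩
    have : C c * r = r' + (C c * r - r') := by ring
    rw [this]
    refine Ideal.add_mem _ (Ideal.mem_sup_left hr') (Ideal.mem_sup_right ?_)
    rw [Ideal.mem_map_C_iff]
    intro n
    rw [← Ideal.algebraMap_residueField_eq_zero, ← coeff_map, Polynomial.map_sub,
      Polynomial.map_mul, map_C, h', sub_self, coeff_zero]
  intro z hz
  induction hz using Submodule.span_induction with
  | mem z hz =>
    obtain ⟨s, hs, rfl⟩ := hz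
    exact ⟨1, (Ideal.ne_top_iff_one p).1 Ideal.IsPrime.ne_top', s, Ideal.subset_span hs, by simp⟩
  | zero => exact ⟨1, (Ideal.ne_top_iff_one p).1 Ideal.IsPrime.ne_top', 0, zero_mem _, by simp⟩
  | add x y _ _ hx hy =>
    obtain ⟨c, hc, r, hr, h1⟩ := hx
    obtain ⟨d, hd, s, hs, h2⟩ := hy
    refine ⟨c * d, fun h => (Ideal.IsPrime.mem_or_mem ‹_› h).elim hc hd, C d * r + C c * s,
      Ideal.add_mem _ (Ideal.mul_mem_left _ _ hr) (Ideal.mul_mem_left _ _ hs), ?_⟩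
    simp only [Polynomial.map_add, Polynomial.map_mul, map_C, h1, h2, map_mul]
    ring
  | smul a x _ hx =>
    obtain ⟨c, hc, r, hr, h1⟩ := hx
    obtain ⟨d, hd, s, h2⟩ := exists_map_eq_C_mul a
    refine ⟨c * d, fun h => (Ideal.IsPrime.mem_or_mem ‹_› h).elim hc hd, s * r,
      Ideal.mul_mem_left _ _ hr, ?_⟩
    simp only [Polynomial.map_mul, h1, h2, map_mul, smul_eq_mul]
    ring

/-- The lift has the same degree, which makes its leading coefficient nonzero at `p`. -/
lemma exists_lift_associated {w : p.ResidueField[X]} (hw : w ≠ 0) :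
    ∃ W : R[X], Associated (W.map (algebraMap R p.ResidueField)) w ∧ W.leadingCoeff ∉ p := by
  obtain ⟨c, hc, r, hr⟩ := exists_map_eq_C_mul w
  have hc' : algebraMap R p.ResidueField c ≠ 0 := by
    rwa [Ne, Ideal.algebraMap_residueField_eq_zero]
  obtain ⟨W, hW, hdeg⟩ := exists_natDegree_eq_of_mem_lifts
    ((mem_lifts (f := algebraMap R p.ResidueField) _).2 ⟨r, hr⟩)
  refine ⟨W, ?_, ?_⟩
  · rw [hW, mul_comm]
    exact associated_mul_unit_left _ _ (isUnit_C.2 (isUnit_iff_ne_zero.2 hc'))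
  · rw [← Ideal.algebraMap_residueField_eq_zero, leadingCoeff, ← coeff_map, hdeg, hW,
      coeff_natDegree, leadingCoeff_eq_zero]
    exact mul_ne_zero (C_ne_zero.2 hc') hw

variable {Ω : Type*} [Field Ω]

omit [p.IsPrime] in
lemma eval₂_eq_zero_of_mem_map_C {φ : R →+* Ω} (hφ : p ≤ RingHom.ker φ) (y : Ω) {r : R[X]}
    (hr : r ∈ p.map (C : R →+* R[X])) : r.eval₂ φ y = 0 := by
  have : p.map (C : R →+* R[X]) ≤ RingHom.ker (eval₂RingHom φ y) := by
    rw [Ideal.map_le_iff_le_comap]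
    intro a ha
    simpa using hφ ha
  exact this hr

lemma eval₂_eq_zero_of_map_eq_zero {φ : R →+* Ω} (hφ : p ≤ RingHom.ker φ) (y : Ω) {r : R[X]}
    (hr : r.map (algebraMap R p.ResidueField) = 0) : r.eval₂ φ y = 0 := by
  refine eval₂_eq_zero_of_mem_map_C hφ y (Ideal.mem_map_C_iff.2 fun n => ?_)
  rw [← Ideal.algebraMap_residueField_eq_zero, ← coeff_map, hr, coeff_zero]

variable (Ω) in
/-- Specialization at the points `φ` of a nonempty open part of `V(p)` preserves a given ideal
membership over the residue field of `p`, as far as zeros are concerned. -/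
lemma exists_forall_eval₂_eq_zero {S : Set R[X]} {r : R[X]}
    (h : r.map (algebraMap R p.ResidueField) ∈
      Ideal.span ((fun f : R[X] => f.map (algebraMap R p.ResidueField)) '' S)) :
    ∃ c ∉ p, ∀ φ : R →+* Ω, p ≤ RingHom.ker φ → φ c ≠ 0 → ∀ y : Ω,
      (∀ s ∈ S, s.eval₂ φ y = 0) → r.eval₂ φ y = 0 := by
  obtain ⟨c, hc, hmem⟩ := exists_C_mul_mem h
  refine ⟨c, hc, fun φ hφ hφc y hy => ?_⟩
  obtain ⟨a, ha, b, hb, hab⟩ := Submodule.mem_sup.1 hmem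
  have h1 : a.eval₂ φ y = 0 := by
    have : Ideal.span S ≤ RingHom.ker (eval₂RingHom φ y) :=
      Ideal.span_le.2 fun s hs => hy s hs
    exact this ha
  have h2 := congrArg (eval₂ φ y) hab
  rw [eval₂_add, h1, eval₂_eq_zero_of_mem_map_C hφ y hb, eval₂_mul, eval₂_C, add_zero] at h2
  exact (mul_eq_zero.1 h2.symm).resolve_left hφc

variable (Ω) in
lemma exists_forall_squarefree {W : R[X]} (h : (W.map (algebraMap R p.ResidueField)).Separable) :
    ∃ c ∉ p, ∀ φ : R →+* Ω, p ≤ RingHom.ker φ → φ c ≠ 0 → Squarefree (W.map φ) := by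
  obtain ⟨c, hc, hmem⟩ := exists_C_mul_mem (p := p) (S := {W, derivative W}) (r := 1) (by
    rw [Set.image_pair, ← derivative_map, Ideal.mem_span_pair, Polynomial.map_one]
    exact h)
  refine ⟨c, hc, fun φ hφ hφc => Separable.squarefree ?_⟩
  obtain ⟨a, ha, b, hb, hab⟩ := Submodule.mem_sup.1 hmem
  obtain ⟨u, v, rfl⟩ := Ideal.mem_span_pair.1 ha
  have hb' : b.map φ = 0 := by
    ext n
    rw [coeff_map, coeff_zero]
    exact hφ (Ideal.mem_map_C_iff.1 hb n)
  have h1 := congrArg (Polynomial.map φ) hab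
  simp only [Polynomial.map_add, Polynomial.map_mul, hb', add_zero, map_C,
    mul_one, ← derivative_map] at h1
  have h2 : C (φ c)⁻¹ * C (φ c) = 1 := by
    rw [← C_mul, inv_mul_cancel₀ hφc, C_1]
  refine ⟨C (φ c)⁻¹ * u.map φ, C (φ c)⁻¹ * v.map φ, ?_⟩
  rw [mul_assoc, mul_assoc, ← mul_add, h1, h2]

end generic

/-! ### Fibrewise squarefree decomposition of univariate systems with parameters -/

/-- A piece of a decomposition of a system of univariate polynomials over `R`: equations and
inequations in `R`, which cut out a set of parameter values, and a univariate system, which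
describes the fibres over this set. -/
structure FiberPiece (R : Type*) [CommRing R] where
  baseEqs : Finset R
  baseIneqs : Finset R
  eqs : Finset R[X]
  ineqs : Finset R[X]

section fibers

variable {R : Type*} [CommRing R] {Ω : Type*} [Field Ω]

/-- `y` satisfies the equations `F` and the inequations `H`, specialized at `φ`. -/
def InFiber (F H : Finset R[X]) (φ : R →+* Ω) (y : Ω) : Prop :=
  (∀ f ∈ F, f.eval₂ φ y = 0) ∧ ∀ h ∈ H, h.eval₂ φ y ≠ 0

/-- The parameter value `φ` belongs to the base of the piece. -/
def FiberPiece.OnBase (P : FiberPiece R) (φ : R →+* Ω) : Prop :=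
  (∀ e ∈ P.baseEqs, φ e = 0) ∧ ∀ d ∈ P.baseIneqs, φ d ≠ 0

variable (Ω) in
/-- The fibres of the piece are given by at most one polynomial, an equation or an inequation, of
positive degree, whose leading coefficient vanishes nowhere on the base and whose specializations
are squarefree. -/
structure FiberPiece.IsSquarefree (P : FiberPiece R) : Prop where
  eqs_unique : ∀ f ∈ P.eqs, ∀ g ∈ P.eqs, f = g
  eqs_or_ineqs : P.eqs = ∅ ∨ P.ineqs = ∅
  natDegree_pos : ∀ g, g ∈ P.eqs ∨ g ∈ P.ineqs → 0 < g.natDegree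
  leadingCoeff_ne_zero : ∀ g, g ∈ P.eqs ∨ g ∈ P.ineqs →
    ∀ φ : R →+* Ω, P.OnBase φ → φ g.leadingCoeff ≠ 0
  squarefree : ∀ g, g ∈ P.eqs ∨ g ∈ P.ineqs → ∀ φ : R →+* Ω, P.OnBase φ → Squarefree (g.map φ)

variable (Ω) in
/-- The pieces `L` lie in the zero set of the system `(F, H)`, and are squarefree. -/
def IsFiberPacking (F H : Finset R[X]) (L : List (FiberPiece R)) : Prop :=
  ∀ P ∈ L, P.IsSquarefree Ω ∧
    ∀ φ : R →+* Ω, P.OnBase φ → ∀ y, InFiber P.eqs P.ineqs φ y → InFiber F H φ y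

/-- The pieces `L` cover the fibre at `φ` of the zero set of the system `(F, H)`. -/
def CoversFiber (F H : Finset R[X]) (L : List (FiberPiece R)) (φ : R →+* Ω) : Prop :=
  ∀ y, InFiber F H φ y → ∃ P ∈ L, P.OnBase φ ∧ InFiber P.eqs P.ineqs φ y

lemma inFiber_iff {F H : Finset R[X]} {φ : R →+* Ω} {y : Ω} :
    InFiber F H φ y ↔ (∀ f ∈ F, f.eval₂ φ y = 0) ∧ (∏ h ∈ H, h).eval₂ φ y ≠ 0 := by
  rw [InFiber, ← coe_eval₂RingHom, map_prod, Finset.prod_ne_zero_iff]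

variable (Ω) in
/-- If the fibres of a system are given generically on `V(p)` by one polynomial, separable over the
residue field of `p`, then they are given by squarefree pieces over a nonempty open part. -/
lemma exists_generic_pieces_of_iff [IsNoetherianRing R] {p : Ideal R} [p.IsPrime]
    {F H : Finset R[X]} {W : R[X]} (hWp : W.leadingCoeff ∉ p)
    (hsep : (W.map (algebraMap R p.ResidueField)).Separable) {c : R} (hc : c ∉ p)
    (hW : (∀ φ : R →+* Ω, p ≤ RingHom.ker φ → φ c ≠ 0 →
        ∀ y, (InFiber F H φ y ↔ W.eval₂ φ y = 0)) ∨
      (∀ φ : R →+* Ω, p ≤ RingHom.ker φ → φ c ≠ 0 →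
        ∀ y, (InFiber F H φ y ↔ W.eval₂ φ y ≠ 0))) :
    ∃ d ∉ p, ∃ L, IsFiberPacking Ω F H L ∧
      ∀ φ : R →+* Ω, p ≤ RingHom.ker φ → φ d ≠ 0 → CoversFiber F H L φ := by
  obtain ⟨c₁, hc₁, h₁⟩ := exists_forall_squarefree Ω hsep
  obtain ⟨s, hs⟩ := IsNoetherian.noetherian p
  have hker : ∀ φ : R →+* Ω, (∀ e ∈ s, φ e = 0) → p ≤ RingHom.ker φ := by
    intro φ hφ
    rw [← hs]
    exact Ideal.span_le.2 fun e he => hφ e he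
  have hsp : ∀ φ : R →+* Ω, p ≤ RingHom.ker φ → ∀ e ∈ s, φ e = 0 := fun φ hφ e he =>
    hφ (hs ▸ Ideal.subset_span he)
  have hd : c * c₁ * W.leadingCoeff ∉ p := by
    simp only [Ideal.IsPrime.mul_mem_iff_mem_or_mem, not_or]
    exact ⟨⟨hc, hc₁⟩, hWp⟩
  have hdφ : ∀ φ : R →+* Ω, φ (c * c₁ * W.leadingCoeff) ≠ 0 →
      (φ c ≠ 0 ∧ φ c₁ ≠ 0) ∧ φ W.leadingCoeff ≠ 0 := by
    intro φ hφ
    simpa only [map_mul, mul_ne_zero_iff] using hφ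
  have hbase : ∀ (E I : Finset R[X]) (φ : R →+* Ω),
      (FiberPiece.mk s {c * c₁ * W.leadingCoeff} E I).OnBase φ ↔
        p ≤ RingHom.ker φ ∧ φ (c * c₁ * W.leadingCoeff) ≠ 0 := by
    intro E I φ
    simp only [FiberPiece.OnBase, Finset.mem_singleton, forall_eq]
    exact ⟨fun h => ⟨hker φ h.1, h.2⟩, fun h => ⟨hsp φ h.1, h.2⟩⟩
  -- a system given by the polynomials `E`, `I`, one of them empty and the other `W` or empty
  have main : ∀ E I : Finset R[X], (∀ f ∈ E, ∀ g ∈ E, f = g) → (E = ∅ ∨ I = ∅) →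
      (∀ g, g ∈ E ∨ g ∈ I → g = W ∧ 0 < W.natDegree) →
      (∀ φ : R →+* Ω, p ≤ RingHom.ker φ → φ (c * c₁ * W.leadingCoeff) ≠ 0 →
        ∀ y, (InFiber F H φ y ↔ InFiber E I φ y)) →
      ∃ d ∉ p, ∃ L, IsFiberPacking Ω F H L ∧
        ∀ φ : R →+* Ω, p ≤ RingHom.ker φ → φ d ≠ 0 → CoversFiber F H L φ := by
    intro E I h1 h2 h3 h4
    refine ⟨_, hd, [⟨s, {c * c₁ * W.leadingCoeff}, E, I⟩], ?_, ?_⟩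
    · intro P hP
      rw [List.mem_singleton] at hP
      subst hP
      refine ⟨⟨h1, h2, fun g hg => (h3 g hg).1 ▸ (h3 g hg).2, ?_, ?_⟩, ?_⟩
      · intro g hg φ hφ
        rw [(h3 g hg).1]
        exact (hdφ φ ((hbase _ _ _).1 hφ).2).2
      · intro g hg φ hφ
        rw [(h3 g hg).1]
        exact h₁ φ ((hbase _ _ _).1 hφ).1 (hdφ φ ((hbase _ _ _).1 hφ).2).1.2
      · intro φ hφ y hy
        exact (h4 φ ((hbase _ _ _).1 hφ).1 ((hbase _ _ _).1 hφ).2 y).2 hy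
    · intro φ hφ hφd y hy
      exact ⟨_, List.mem_singleton_self _, (hbase _ _ _).2 ⟨hφ, hφd⟩, (h4 φ hφ hφd y).1 hy⟩
  have hconst : W.natDegree = 0 → ∀ φ : R →+* Ω, φ (c * c₁ * W.leadingCoeff) ≠ 0 → ∀ y,
      W.eval₂ φ y ≠ 0 := by
    intro h0 φ hφ y
    have := (hdφ φ hφ).2
    rw [leadingCoeff, h0] at this
    rwa [eq_C_of_natDegree_eq_zero h0, eval₂_C]
  -- a constant `W` is a nonzero constant: as an equation it has no zeros, as an inequation it is
  -- no condition
  rcases Nat.eq_zero_or_pos W.natDegree with h0 | hpos <;> rcases hW with hW | hW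
  · refine ⟨_, hd, [], by simp [IsFiberPacking], fun φ hφ hφd y hy => ?_⟩
    exact absurd ((hW φ hφ (hdφ φ hφd).1.1 y).1 hy) (hconst h0 φ hφd y)
  · refine main ∅ ∅ (by simp) (by simp) (by simp) fun φ hφ hφd y => ?_
    rw [hW φ hφ (hdφ φ hφd).1.1 y]
    simpa [InFiber] using hconst h0 φ hφd y
  · refine main {W} ∅ (by simp) (by simp) (by simpa using hpos) fun φ hφ hφd y => ?_
    rw [hW φ hφ (hdφ φ hφd).1.1 y]
    simp [InFiber]
  · refine main ∅ {W} (by simp) (by simp) (by simpa using hpos) fun φ hφ hφd y => ?_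
    rw [hW φ hφ (hdφ φ hφd).1.1 y]
    simp [InFiber]

variable (Ω) in
/-- The generic part of the decomposition over `V(p)`. If all equations vanish over the residue
field of `p`, the fibres are given by the squarefree part of the product `h` of the inequations;
otherwise they are given by the squarefree part of the greatest common divisor of the equations,
without its common factors with `h`. -/
lemma exists_generic_pieces [IsNoetherianRing R] (p : Ideal R) [p.IsPrime]
    [CharZero p.ResidueField] (F H : Finset R[X]) :
    ∃ d ∉ p, ∃ L, IsFiberPacking Ω F H L ∧
      ∀ φ : R →+* Ω, p ≤ RingHom.ker φ → φ d ≠ 0 → CoversFiber F H L φ := by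
  have h1p : (1 : R) ∉ p := (Ideal.ne_top_iff_one p).1 Ideal.IsPrime.ne_top'
  set h := ∏ h ∈ H, h with hh
  by_cases hF : ∀ f ∈ F, f.map (algebraMap R p.ResidueField) = 0
  · by_cases h0 : h.map (algebraMap R p.ResidueField) = 0
    · refine ⟨1, h1p, [], by simp [IsFiberPacking], fun φ hφ _ y hy => ?_⟩
      exact absurd (eval₂_eq_zero_of_map_eq_zero hφ y h0) (inFiber_iff.1 hy).2
    obtain ⟨w, N, hw, hwh, -, hhw⟩ := exists_squarefree_isCoprime h0 1
    rw [mul_one] at hhw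
    obtain ⟨W, hWw, hWp⟩ := exists_lift_associated (p := p) hw.ne_zero
    rw [← hWw.dvd_iff_dvd_left] at hwh
    rw [← (hWw.pow_pow (n := N)).dvd_iff_dvd_right] at hhw
    obtain ⟨c₂, hc₂, h₂⟩ := exists_forall_eval₂_eq_zero Ω (p := p) (S := {W}) (r := h)
      (by rwa [Set.image_singleton, Ideal.mem_span_singleton])
    obtain ⟨c₃, hc₃, h₃⟩ := exists_forall_eval₂_eq_zero Ω (p := p) (S := {h}) (r := W ^ N)
      (by rwa [Set.image_singleton, Ideal.mem_span_singleton, Polynomial.map_pow])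
    refine exists_generic_pieces_of_iff Ω hWp
      (PerfectField.separable_iff_squarefree.2 (hWw.squarefree_iff.2 hw)) (c := c₂ * c₃) ?_
      (Or.inr fun φ hφ hφc y => ?_)
    · simp only [Ideal.IsPrime.mul_mem_iff_mem_or_mem, not_or]
      exact ⟨hc₂, hc₃⟩
    · rw [map_mul, mul_ne_zero_iff] at hφc
      rw [inFiber_iff, ← hh]
      refine ⟨fun hy hW => hy.2 (h₂ φ hφ hφc.1 y (by simpa using hW)), fun hW =>
        ⟨fun f hf => eval₂_eq_zero_of_map_eq_zero hφ y (hF f hf), fun hy => hW ?_⟩⟩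
      have := h₃ φ hφ hφc.2 y (by simpa using hy)
      rw [eval₂_pow] at this
      exact eq_zero_of_pow_eq_zero this
  · set I := Ideal.span ((fun f : R[X] => f.map (algebraMap R p.ResidueField)) '' F) with hI
    obtain ⟨g, hg⟩ := (IsPrincipalIdealRing.principal I).principal
    rw [Ideal.submodule_span_eq] at hg
    have hFg : ∀ f ∈ F, g ∣ f.map (algebraMap R p.ResidueField) := by
      intro f hf
      rw [← Ideal.mem_span_singleton, ← hg]
      exact Ideal.subset_span ⟨f, hf, rfl⟩
    have hg0 : g ≠ 0 := by
      rintro rfl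
      exact hF fun f hf => zero_dvd_iff.1 (hFg f hf)
    obtain ⟨w, N, hw, hwg, hwh, hgw⟩ :=
      exists_squarefree_isCoprime hg0 (h.map (algebraMap R p.ResidueField))
    obtain ⟨W, hWw, hWp⟩ := exists_lift_associated (p := p) hw.ne_zero
    rw [← hWw.dvd_iff_dvd_left] at hwg
    rw [← ((hWw.mul_right _).pow_pow (n := N)).dvd_iff_dvd_right] at hgw
    have h₁ : ∀ f : R[X], ∃ c ∉ p, f ∈ F → ∀ φ : R →+* Ω, p ≤ RingHom.ker φ → φ c ≠ 0 → ∀ y : Ω,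
        (∀ s ∈ ({W} : Set R[X]), s.eval₂ φ y = 0) → f.eval₂ φ y = 0 := by
      intro f
      by_cases hf : f ∈ F
      · obtain ⟨c, hc, h⟩ := exists_forall_eval₂_eq_zero Ω (p := p) (S := {W}) (r := f) (by
          rw [Set.image_singleton, Ideal.mem_span_singleton]
          exact hwg.trans (hFg f hf))
        exact ⟨c, hc, fun _ => h⟩
      · exact ⟨1, h1p, fun h => absurd h hf⟩
    choose c₁ hc₁ h₁ using h₁
    obtain ⟨c₂, hc₂, h₂⟩ := exists_forall_eval₂_eq_zero Ω (p := p) (S := {W, h}) (r := 1) (by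
      rw [Set.image_pair, Polynomial.map_one, Ideal.mem_span_pair]
      have : IsCoprime (W.map (algebraMap R p.ResidueField))
          (h.map (algebraMap R p.ResidueField)) := by
        obtain ⟨v, hv⟩ := hWw
        rw [← hv] at hwh
        exact hwh.of_mul_left_left
      exact this)
    obtain ⟨c₃, hc₃, h₃⟩ := exists_forall_eval₂_eq_zero Ω (p := p) (S := F) (r := (W * h) ^ N) (by
      rwa [← hI, hg, Ideal.mem_span_singleton, Polynomial.map_pow, Polynomial.map_mul])
    refine exists_generic_pieces_of_iff Ω hWp
      (PerfectField.separable_iff_squarefree.2 (hWw.squarefree_iff.2 hw))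
      (c := (∏ f ∈ F, c₁ f) * c₂ * c₃) ?_ (Or.inl fun φ hφ hφc y => ?_)
    · simp only [Ideal.IsPrime.mul_mem_iff_mem_or_mem, not_or]
      refine ⟨⟨?_, hc₂⟩, hc₃⟩
      exact prod_mem (S := p.primeCompl) fun f _ => hc₁ f
    · rw [map_mul, map_mul, mul_ne_zero_iff, mul_ne_zero_iff, map_prod,
        Finset.prod_ne_zero_iff] at hφc
      rw [inFiber_iff, ← hh]
      refine ⟨fun hy => ?_, fun hW =>
        ⟨fun f hf => h₁ f hf φ hφ (hφc.1.1 f hf) y (by simpa using hW), fun hy => ?_⟩⟩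
      · have := h₃ φ hφ hφc.2 y hy.1
        rw [eval₂_pow, eval₂_mul] at this
        exact (mul_eq_zero.1 (eq_zero_of_pow_eq_zero this)).resolve_right hy.2
      · simpa using h₂ φ hφ hφc.1.2 y (by
          rintro s (rfl | hs)
          · exact hW
          · rw [Set.mem_singleton_iff.1 hs]; exact hy)

variable (Ω) in
/-- Fibrewise squarefree decomposition, by Noetherian induction on the closed set `V(I)` of
parameter values. -/
theorem exists_fiber_decomposition (k : Type*) [Field k] [CharZero k] [Algebra k R]
    [IsNoetherianRing R] (F H : Finset R[X]) (I : Ideal R) :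
    ∃ L, IsFiberPacking Ω F H L ∧ ∀ φ : R →+* Ω, I ≤ RingHom.ker φ → CoversFiber F H L φ := by
  induction I using WellFoundedGT.induction with
  | ind I ih =>
    have hsup : ∀ {a : R} {φ : R →+* Ω}, I ≤ RingHom.ker φ → φ a = 0 →
        I ⊔ Ideal.span {a} ≤ RingHom.ker φ := by
      intro a φ h1 h2
      rw [sup_le_iff, Ideal.span_singleton_le_iff_mem]
      exact ⟨h1, h2⟩
    have hlt : ∀ {a : R}, a ∉ I → I < I ⊔ Ideal.span {a} := by
      intro a ha
      rw [left_lt_sup, Ideal.span_singleton_le_iff_mem]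
      exact ha
    have happ : ∀ {L₁ L₂ : List (FiberPiece R)}, IsFiberPacking Ω F H L₁ →
        IsFiberPacking Ω F H L₂ → IsFiberPacking Ω F H (L₁ ++ L₂) := by
      intro L₁ L₂ h1 h2 P hP
      exact (List.mem_append.1 hP).elim (h1 P) (h2 P)
    have hcovl : ∀ {L₁ L₂ : List (FiberPiece R)} {φ : R →+* Ω}, CoversFiber F H L₁ φ →
        CoversFiber F H (L₁ ++ L₂) φ := by
      intro L₁ L₂ φ h y hy
      obtain ⟨P, hP, h⟩ := h y hy
      exact ⟨P, List.mem_append_left _ hP, h⟩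
    have hcovr : ∀ {L₁ L₂ : List (FiberPiece R)} {φ : R →+* Ω}, CoversFiber F H L₂ φ →
        CoversFiber F H (L₁ ++ L₂) φ := by
      intro L₁ L₂ φ h y hy
      obtain ⟨P, hP, h⟩ := h y hy
      exact ⟨P, List.mem_append_right _ hP, h⟩
    by_cases hI : I.IsPrime
    · have : CharZero I.ResidueField :=
        charZero_of_injective_algebraMap (algebraMap k I.ResidueField).injective
      obtain ⟨d, hd, L₁, h1, h1'⟩ := exists_generic_pieces Ω I F H
      obtain ⟨L₂, h2, h2'⟩ := ih _ (hlt hd)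
      refine ⟨L₁ ++ L₂, happ h1 h2, fun φ hφ => ?_⟩
      by_cases hφd : φ d = 0
      · exact hcovr (h2' φ (hsup hφ hφd))
      · exact hcovl (h1' φ hφ hφd)
    · rcases Ideal.not_isPrime_iff.1 hI with rfl | ⟨a, ha, b, hb, hab⟩
      · refine ⟨[], by simp [IsFiberPacking], fun φ hφ => ?_⟩
        have h1 : φ 1 = 0 := hφ Submodule.mem_top
        simp at h1
      · obtain ⟨L₁, h1, h1'⟩ := ih _ (hlt ha)
        obtain ⟨L₂, h2, h2'⟩ := ih _ (hlt hb)
        refine ⟨L₁ ++ L₂, happ h1 h2, fun φ hφ => ?_⟩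
        have h0 : φ (a * b) = 0 := hφ hab
        rw [map_mul, mul_eq_zero] at h0
        rcases h0 with h0 | h0
        · exact hcovl (h1' φ (hsup hφ h0))
        · exact hcovr (h2' φ (hsup hφ h0))

end fibers

end

end ChordalNet

namespace ChordalNet

open MvPolynomial

noncomputable section

section

variable {K : Type*} [Field K] {n : ℕ}

/-! ### Existence of squarefree triangular decompositions -/

section adjoin

variable (k : Fin n) (W : Set (Fin n))

/-- Univariate polynomials over `K[W]` as polynomials in the variables `W` and `x_k`. -/
def ofPoly : Polynomial (supported K W) →+* MvPolynomial (Fin n) K :=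
  Polynomial.eval₂RingHom (algebraMap (supported K W) (MvPolynomial (Fin n) K)) (X k)

variable {k W}

lemma ofPoly_C (a : supported K W) : ofPoly k W (Polynomial.C a) = a := by
  simp [ofPoly]

lemma ofPoly_X : ofPoly (K := K) k W Polynomial.X = X k := by
  simp [ofPoly]

lemma exists_ofPoly_eq {f : MvPolynomial (Fin n) K} (hf : f ∈ supported K (insert k W)) :
    ∃ g, ofPoly k W g = f := by
  rw [supported_eq_adjoin_X] at hf
  induction hf using Algebra.adjoin_induction with
  | mem f hf =>
    obtain ⟨i, rfl | hi, rfl⟩ := hf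
    · exact ⟨Polynomial.X, ofPoly_X⟩
    · exact ⟨Polynomial.C ⟨X i, X_mem_supported.2 hi⟩, ofPoly_C _⟩
  | algebraMap r => exact ⟨Polynomial.C (algebraMap K _ r), ofPoly_C _⟩
  | add f g _ _ hf hg =>
    obtain ⟨a, rfl⟩ := hf
    obtain ⟨b, rfl⟩ := hg
    exact ⟨a + b, map_add _ _ _⟩
  | mul f g _ _ hf hg =>
    obtain ⟨a, rfl⟩ := hf
    obtain ⟨b, rfl⟩ := hg
    exact ⟨a * b, map_mul _ _ _⟩

lemma ofPoly_mem_supported (g : Polynomial (supported K W)) :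
    ofPoly k W g ∈ supported K (insert k W) := by
  induction g using Polynomial.induction_on' with
  | add p q hp hq => rw [map_add]; exact add_mem hp hq
  | monomial m a =>
    rw [← Polynomial.C_mul_X_pow_eq_monomial, map_mul, map_pow, ofPoly_C, ofPoly_X]
    exact mul_mem (supported_mono (Set.subset_insert _ _) a.2)
      (pow_mem (X_mem_supported.2 (Set.mem_insert _ _)) _)

lemma toPoly_ofPoly (hk : k ∉ W) (g : Polynomial (supported K W)) :
    toPoly k (ofPoly k W g) =
      g.map (algebraMap (supported K W) (MvPolynomial (Fin n) K)) := by
  induction g using Polynomial.induction_on' with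
  | add p q hp hq => rw [map_add, map_add, hp, hq, Polynomial.map_add]
  | monomial m a =>
    rw [← Polynomial.C_mul_X_pow_eq_monomial, map_mul, map_pow, ofPoly_C, ofPoly_X, map_mul,
      map_pow, toPoly_of_notMem_vars fun h => hk (mem_supported.1 a.2 h)]
    simp [toPoly]

lemma algebraMap_supported_injective :
    Function.Injective (algebraMap (supported K W) (MvPolynomial (Fin n) K)) :=
  Subtype.val_injective

lemma degreeOf_ofPoly (hk : k ∉ W) (g : Polynomial (supported K W)) :
    (ofPoly k W g).degreeOf k = g.natDegree := by
  rw [← natDegree_toPoly, toPoly_ofPoly hk,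
    Polynomial.natDegree_map_eq_of_injective algebraMap_supported_injective]

lemma isMainVar_ofPoly (hW : ∀ i ∈ W, k < i) {g : Polynomial (supported K W)}
    (hg : 0 < g.natDegree) : IsMainVar (ofPoly k W g) k := by
  constructor
  · rw [mem_vars_iff_degreeOf_ne_zero, degreeOf_ofPoly fun h => (hW k h).false]
    exact hg.ne'
  · intro i hi
    rcases mem_supported.1 (ofPoly_mem_supported g) hi with rfl | h
    · exact le_rfl
    · exact (hW i h).le

lemma initial_ofPoly (hW : ∀ i ∈ W, k < i) {g : Polynomial (supported K W)}
    (hg : 0 < g.natDegree) : initial (ofPoly k W g) = g.leadingCoeff := by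
  rw [(isMainVar_ofPoly hW hg).initial_eq, toPoly_ofPoly fun h => (hW k h).false,
    Polynomial.leadingCoeff_map_of_injective algebraMap_supported_injective]
  rfl

/-- The parameter value given by a point: evaluation of the polynomials in the variables `W`. -/
def pointHom (W : Set (Fin n)) (x : Fin n → AlgebraicClosure K) :
    supported K W →+* AlgebraicClosure K :=
  (aeval x : MvPolynomial (Fin n) K →ₐ[K] _).toRingHom.comp (algebraMap (supported K W) _)

lemma pointHom_apply (x : Fin n → AlgebraicClosure K) (a : supported K W) :
    pointHom W x a = aeval x (a : MvPolynomial (Fin n) K) := rfl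

lemma aeval_ofPoly (x : Fin n → AlgebraicClosure K) (g : Polynomial (supported K W)) :
    aeval x (ofPoly k W g) = g.eval₂ (pointHom W x) (x k) := by
  induction g using Polynomial.induction_on' with
  | add p q hp hq => rw [map_add, map_add, hp, hq, Polynomial.eval₂_add]
  | monomial m a =>
    rw [← Polynomial.C_mul_X_pow_eq_monomial, map_mul, map_pow, ofPoly_C, ofPoly_X]
    simp [pointHom_apply]

lemma specialize_ofPoly (hk : k ∉ W) (x : Fin n → AlgebraicClosure K)
    (g : Polynomial (supported K W)) :
    specialize k x (ofPoly k W g) = g.map (pointHom W x) := by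
  rw [← map_aeval_toPoly, toPoly_ofPoly hk, Polynomial.map_map]
  rfl

end adjoin

lemma PolySystem.zeros_concat (S S' : PolySystem K n) :
    (S.concat S').zeros = S.zeros ∩ S'.zeros := by
  ext x
  simp only [PolySystem.zeros, PolySystem.concat, Finset.mem_union, Set.mem_ofPred_eq,
    Set.mem_inter_iff]
  constructor
  · rintro ⟨h1, h2⟩
    exact ⟨⟨fun f hf => h1 f (Or.inl hf), fun f hf => h2 f (Or.inl hf)⟩,
      fun f hf => h1 f (Or.inr hf), fun f hf => h2 f (Or.inr hf)⟩
  · rintro ⟨⟨h1, h2⟩, h3, h4⟩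
    exact ⟨fun f hf => hf.elim (h1 f) (h3 f), fun f hf => hf.elim (h2 f) (h4 f)⟩

/-- `A` is a system with at most one polynomial, of main variable `x_k`, whose initial vanishes
nowhere, and whose specializations are squarefree, over the zeros of `B`. -/
structure IsTop (k : Fin n) (B A : PolySystem K n) : Prop where
  eqs_unique : ∀ f ∈ A.eqs, ∀ g ∈ A.eqs, f = g
  eqs_or_ineqs : A.eqs = ∅ ∨ A.ineqs = ∅
  isMainVar : ∀ f, f ∈ A.eqs ∨ f ∈ A.ineqs → IsMainVar f k
  initial_ne_zero : ∀ f, f ∈ A.eqs ∨ f ∈ A.ineqs → ∀ x ∈ B.zeros, aeval x (initial f) ≠ 0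
  squarefree : ∀ f, f ∈ A.eqs ∨ f ∈ A.ineqs → ∀ x ∈ B.zeros, Squarefree (specialize k x f)

/-- One step of elimination: a system in `x_k` and smaller variables `W` is decomposed into
systems in `W`, each with a single polynomial in `x_k` on top. -/
lemma exists_elimination_step [CharZero K] {k : Fin n} {W : Set (Fin n)} (hW : ∀ i ∈ W, k < i)
    {S : PolySystem K n} (hS : S.SupportedIn (insert k W)) :
    ∃ L : List (PolySystem K n × PolySystem K n),
      (∀ P ∈ L, P.1.SupportedIn W ∧ P.2.SupportedIn (insert k W) ∧ IsTop k P.1 P.2) ∧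
      ∀ x, x ∈ S.zeros ↔ ∃ P ∈ L, x ∈ P.1.zeros ∧ x ∈ P.2.zeros := by
  classical
  have : IsNoetherianRing (supported K W) :=
    isNoetherianRing_of_ringEquiv _ (supportedEquivMvPolynomial W).symm.toRingEquiv
  have hk : k ∉ W := fun h => (hW k h).false
  have hex : ∀ f ∈ supported K (insert k W), ∃ g, ofPoly k W g = f := fun f => exists_ofPoly_eq
  choose! lift hlift using hex
  obtain ⟨L, hL, hcov⟩ := exists_fiber_decomposition (AlgebraicClosure K) K
    (S.eqs.image lift)
    (S.ineqs.image lift) ⊥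
  have hzero : ∀ x, x ∈ S.zeros ↔ InFiber (S.eqs.image lift)
      (S.ineqs.image lift) (pointHom W x) (x k) := by
    intro x
    simp only [InFiber, Finset.forall_mem_image, ← aeval_ofPoly]
    constructor
    · rintro ⟨h1, h2⟩
      exact ⟨fun f hf => by rw [hlift f (hS.1 f hf)]; exact h1 f hf,
        fun f hf => by rw [hlift f (hS.2 f hf)]; exact h2 f hf⟩
    · rintro ⟨h1, h2⟩
      exact ⟨fun f hf => by rw [← hlift f (hS.1 f hf)]; exact h1 hf,
        fun f hf => by rw [← hlift f (hS.2 f hf)]; exact h2 hf⟩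
  let base (P : FiberPiece (supported K W)) : PolySystem K n :=
    ⟨P.baseEqs.image (↑), P.baseIneqs.image (↑)⟩
  let top (P : FiberPiece (supported K W)) : PolySystem K n :=
    ⟨P.eqs.image (ofPoly k W), P.ineqs.image (ofPoly k W)⟩
  have hbase : ∀ P x, x ∈ (base P).zeros ↔ P.OnBase (pointHom W x) := by
    intro P x
    simp only [base, PolySystem.zeros, FiberPiece.OnBase, Set.mem_ofPred_eq,
      Finset.forall_mem_image, pointHom_apply]
  have htop : ∀ P x, x ∈ (top P).zeros ↔ InFiber P.eqs P.ineqs (pointHom W x) (x k) := by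
    intro P x
    simp only [top, PolySystem.zeros, InFiber, Set.mem_ofPred_eq, Finset.forall_mem_image,
      aeval_ofPoly]
  have hmem : ∀ P f, f ∈ (top P).eqs ∨ f ∈ (top P).ineqs →
      ∃ g, (g ∈ P.eqs ∨ g ∈ P.ineqs) ∧ ofPoly k W g = f := by
    rintro P f (hf | hf)
    · obtain ⟨g, hg, rfl⟩ := Finset.mem_image.1 hf
      exact ⟨g, Or.inl hg, rfl⟩
    · obtain ⟨g, hg, rfl⟩ := Finset.mem_image.1 hf
      exact ⟨g, Or.inr hg, rfl⟩
  refine ⟨L.map fun P => (base P, top P), ?_, fun x => ?_⟩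
  · intro Q hQ
    obtain ⟨P, hP, rfl⟩ := List.mem_map.1 hQ
    have hsq := (hL P hP).1
    refine ⟨⟨?_, ?_⟩, ⟨?_, ?_⟩, ⟨?_, ?_, ?_, ?_, ?_⟩⟩
    · exact Finset.forall_mem_image.2 fun a _ => a.2
    · exact Finset.forall_mem_image.2 fun a _ => a.2
    · exact Finset.forall_mem_image.2 fun g _ => ofPoly_mem_supported g
    · exact Finset.forall_mem_image.2 fun g _ => ofPoly_mem_supported g
    · refine Finset.forall_mem_image.2 fun f hf => Finset.forall_mem_image.2 fun g hg => ?_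
      rw [hsq.eqs_unique f hf g hg]
    · exact hsq.eqs_or_ineqs.imp (fun h => by simp [top, h]) (fun h => by simp [top, h])
    · intro f hf
      obtain ⟨g, hg, rfl⟩ := hmem P f hf
      exact isMainVar_ofPoly hW (hsq.natDegree_pos g hg)
    · intro f hf x hx
      obtain ⟨g, hg, rfl⟩ := hmem P f hf
      rw [initial_ofPoly hW (hsq.natDegree_pos g hg)]
      exact hsq.leadingCoeff_ne_zero g hg _ ((hbase P x).1 hx)
    · intro f hf x hx
      obtain ⟨g, hg, rfl⟩ := hmem P f hf
      rw [specialize_ofPoly hk]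
      exact hsq.squarefree g hg _ ((hbase P x).1 hx)
  · rw [hzero]
    constructor
    · intro h
      obtain ⟨P, hP, h1, h2⟩ := hcov _ bot_le _ h
      exact ⟨_, List.mem_map.2 ⟨P, hP, rfl⟩, (hbase P x).2 h1, (htop P x).2 h2⟩
    · rintro ⟨Q, hQ, h1, h2⟩
      obtain ⟨P, hP, rfl⟩ := List.mem_map.1 hQ
      exact (hL P hP).2 _ ((hbase P x).1 h1) _ ((htop P x).1 h2)

lemma PolySystem.SupportedIn.mono {S : PolySystem K n} {V W : Set (Fin n)} (hS : S.SupportedIn V)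
    (h : V ⊆ W) : S.SupportedIn W :=
  ⟨fun f hf => supported_mono h (hS.1 f hf), fun f hf => supported_mono h (hS.2 f hf)⟩

lemma PolySystem.SupportedIn.concat {S S' : PolySystem K n} {V : Set (Fin n)}
    (hS : S.SupportedIn V) (hS' : S'.SupportedIn V) : (S.concat S').SupportedIn V := by
  classical
  constructor <;> intro f hf <;> rcases Finset.mem_union.1 hf with h | h
  exacts [hS.1 f h, hS'.1 f h, hS.2 f h, hS'.2 f h]

lemma zeros_elim_concat_subset (S S' : PolySystem K n) (p : ℕ) :
    ((S.concat S').elim p).zeros ⊆ (S.elim p).zeros := by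
  rintro x ⟨h1, h2⟩
  simp only [PolySystem.elim, PolySystem.concat, Finset.mem_filter, Finset.mem_union] at h1 h2
  constructor <;> intro f hf <;> simp only [PolySystem.elim, Finset.mem_filter] at hf
  · exact h1 f ⟨Or.inl hf.1, hf.2⟩
  · exact h2 f ⟨Or.inl hf.1, hf.2⟩

lemma elim_eq_self {S : PolySystem K n} {p : ℕ} (h : S.SupportedIn {i | p ≤ (i : ℕ)}) :
    S.elim p = S := by
  ext f
  · simp only [PolySystem.elim, Finset.mem_filter]
    exact ⟨fun h => h.1, fun hf => ⟨hf, h.1 f hf⟩⟩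
  · simp only [PolySystem.elim, Finset.mem_filter]
    exact ⟨fun h => h.1, fun hf => ⟨hf, h.2 f hf⟩⟩

/-- A squarefree regular system in variables smaller than `x_k` stays one when a suitable
polynomial with main variable `x_k` is put on top. -/
lemma IsSquarefreeRegularSystem.concat_top {k : Fin n} {T B A : PolySystem K n}
    (hT : IsSquarefreeRegularSystem T) (hTs : T.SupportedIn {i | (k : ℕ) + 1 ≤ i})
    (hTB : T.zeros ⊆ B.zeros) (hA : IsTop k B A) :
    IsSquarefreeRegularSystem (T.concat A) := by
  classical
  have hnot : ∀ f, f ∈ T.eqs ∨ f ∈ T.ineqs → ¬ IsMainVar f k := by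
    intro f hf hfk
    exact hfk.notMem_supported (Nat.lt_succ_self _) (hf.elim (hTs.1 f) (hTs.2 f))
  have hcase : ∀ f, f ∈ (T.concat A).eqs ∨ f ∈ (T.concat A).ineqs →
      (f ∈ T.eqs ∨ f ∈ T.ineqs) ∨ (f ∈ A.eqs ∨ f ∈ A.ineqs) := by
    intro f hf
    simp only [PolySystem.concat, Finset.mem_union] at hf
    tauto
  have hB : ∀ x ∈ ((T.concat A).elim ((k : ℕ) + 1)).zeros, x ∈ B.zeros := by
    intro x hx
    have := zeros_elim_concat_subset T A _ hx
    rw [elim_eq_self hTs] at this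
    exact hTB this
  refine ⟨⟨⟨?_, ?_⟩, ?_, ?_, ?_⟩, ?_⟩
  · intro f hf
    rcases Finset.mem_union.1 hf with h | h
    · exact hT.triangular.1 f h
    · exact ⟨k, hA.isMainVar f (Or.inl h)⟩
  · intro f hf g hg j hfj hgj
    rcases Finset.mem_union.1 hf with h | h <;> rcases Finset.mem_union.1 hg with h' | h'
    · exact hT.triangular.2 f h g h' j hfj hgj
    · rw [hgj.unique (hA.isMainVar g (Or.inl h'))] at hfj
      exact absurd hfj (hnot f (Or.inl h))
    · rw [hfj.unique (hA.isMainVar f (Or.inl h))] at hgj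
      exact absurd hgj (hnot g (Or.inl h'))
    · exact hA.eqs_unique f h g h'
  · intro u hu
    rcases Finset.mem_union.1 hu with h | h
    · exact hT.ineqs_ne_zero u h
    · exact (hA.isMainVar u (Or.inr h)).ne_zero
  · intro j
    by_cases hj : j = k
    · subst hj
      refine hA.eqs_or_ineqs.imp (fun h f hf => ?_) (fun h f hf => ?_)
      · refine hnot f (Or.inl ?_)
        simpa [PolySystem.concat, h] using hf
      · refine hnot f (Or.inr ?_)
        simpa [PolySystem.concat, h] using hf
    · refine (hT.eqs_or_ineqs j).imp (fun h f hf hfj => ?_) (fun h f hf hfj => ?_)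
      · rcases Finset.mem_union.1 hf with h' | h'
        · exact h f h' hfj
        · exact hj (hfj.unique (hA.isMainVar f (Or.inl h')))
      · rcases Finset.mem_union.1 hf with h' | h'
        · exact h f h' hfj
        · exact hj (hfj.unique (hA.isMainVar f (Or.inr h')))
  · intro j f hf hfj x hx
    rcases hcase f hf with h | h
    · exact hT.initial_ne_zero j f h hfj x (zeros_elim_concat_subset T A _ hx)
    · obtain rfl := hfj.unique (hA.isMainVar f h)
      exact hA.initial_ne_zero f h x (hB x hx)
  · intro j f hf hfj x hx
    rcases hcase f hf with h | h
    · exact hT.specialize_squarefree j f h hfj x (zeros_elim_concat_subset T A _ hx)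
    · obtain rfl := hfj.unique (hA.isMainVar f h)
      exact hA.squarefree f h x (hB x hx)

/-- Every polynomial system has a finite squarefree triangular decomposition in its own
variables. -/
theorem exists_isSquarefreeTriangularDecomposition [CharZero K] (V : Set (Fin n)) {k : ℕ}
    (hk : k ≤ n) : ∀ S : PolySystem K n, S.SupportedIn (V ∩ {i | k ≤ (i : ℕ)}) →
      ∃ L : List (PolySystem K n), IsSquarefreeTriangularDecomposition S {T | T ∈ L} ∧
        ∀ T ∈ L, T.SupportedIn (V ∩ {i | k ≤ (i : ℕ)}) := by
  induction hk using Nat.decreasingInduction with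
  | self =>
    intro S hS
    have h0 : V ∩ {i : Fin n | n ≤ (i : ℕ)} = ∅ := by
      ext i
      simp
    rw [h0] at hS ⊢
    have hc : ∀ f ∈ supported K (∅ : Set (Fin n)), ∀ x y : Fin n → AlgebraicClosure K,
        aeval x f = aeval y f := by
      intro f hf x y
      exact aeval_congr_of_vars fun i hi => absurd (mem_supported.1 hf hi) (Set.notMem_empty i)
    -- a system of constants has all points as zeros, or none
    by_cases hne : ∃ x, x ∈ S.zeros
    · obtain ⟨x, hx⟩ := hne
      refine ⟨[⟨∅, ∅⟩], ⟨?_, ?_⟩, ?_⟩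
      · intro T hT
        rw [Set.mem_ofPred_eq, List.mem_singleton] at hT
        subst hT
        exact ⟨⟨by simp [IsTriangularSet], by simp, by simp, by simp⟩, by simp⟩
      · ext y
        have : y ∈ S.zeros := ⟨fun f hf => by rw [hc f (hS.1 f hf) y x]; exact hx.1 f hf,
          fun f hf => by rw [hc f (hS.2 f hf) y x]; exact hx.2 f hf⟩
        simpa [PolySystem.zeros] using this
      · intro T hT
        rw [List.mem_singleton] at hT
        subst hT
        exact ⟨by simp, by simp⟩
    · refine ⟨[], ⟨by simp, ?_⟩, by simp⟩
      push Not at hne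
      ext y
      simpa using hne y
  | of_succ k hk ih =>
    intro S hS
    have hsub : V ∩ {i : Fin n | k + 1 ≤ (i : ℕ)} ⊆ V ∩ {i : Fin n | k ≤ (i : ℕ)} :=
      fun i hi => ⟨hi.1, Nat.le_of_succ_le hi.2⟩
    by_cases hkV : (⟨k, hk⟩ : Fin n) ∈ V
    · have hins : V ∩ {i : Fin n | k ≤ (i : ℕ)} =
          insert ⟨k, hk⟩ (V ∩ {i : Fin n | k + 1 ≤ (i : ℕ)}) := by
        ext i
        simp only [Set.mem_inter_iff, Set.mem_ofPred_eq, Set.mem_insert_iff, Fin.ext_iff]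
        constructor
        · rintro ⟨h1, h2⟩
          rcases eq_or_lt_of_le h2 with h | h
          · exact Or.inl h.symm
          · exact Or.inr ⟨h1, h⟩
        · rintro (h | ⟨h1, h2⟩)
          · have : i = ⟨k, hk⟩ := Fin.ext h
            exact ⟨this ▸ hkV, h.ge⟩
          · exact ⟨h1, by omega⟩
      rw [hins] at hS ⊢
      obtain ⟨L, hL, hz⟩ := exists_elimination_step (k := ⟨k, hk⟩) (fun i hi => hi.2) hS
      choose! M hM hMs using ih
      refine ⟨L.flatMap fun P => (M P.1).map fun T => T.concat P.2, ⟨?_, ?_⟩, ?_⟩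
      · intro T hT
        simp only [Set.mem_ofPred_eq, List.mem_flatMap, List.mem_map] at hT
        obtain ⟨P, hP, T', hT', rfl⟩ := hT
        obtain ⟨h1, h2, h3⟩ := hL P hP
        refine IsSquarefreeRegularSystem.concat_top ((hM P.1 h1).1 T' hT')
          ((hMs P.1 h1 T' hT').mono fun i hi => hi.2) ?_ h3
        rw [(hM P.1 h1).2]
        exact Set.subset_biUnion_of_mem (u := PolySystem.zeros) hT'
      · ext x
        rw [hz]
        simp only [Set.mem_iUnion, Set.mem_ofPred_eq, List.mem_flatMap, List.mem_map]
        constructor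
        · rintro ⟨P, hP, hx1, hx2⟩
          rw [(hM P.1 (hL P hP).1).2] at hx1
          simp only [Set.mem_iUnion] at hx1
          obtain ⟨T, hT, hxT⟩ := hx1
          exact ⟨_, ⟨P, hP, T, hT, rfl⟩, by rw [PolySystem.zeros_concat]; exact ⟨hxT, hx2⟩⟩
        · rintro ⟨_, ⟨P, hP, T, hT, rfl⟩, hx⟩
          rw [PolySystem.zeros_concat] at hx
          refine ⟨P, hP, ?_, hx.2⟩
          rw [(hM P.1 (hL P hP).1).2]
          exact Set.mem_biUnion (show T ∈ {T | T ∈ M P.1} from hT) hx.1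
      · intro T hT
        simp only [List.mem_flatMap, List.mem_map] at hT
        obtain ⟨P, hP, T', hT', rfl⟩ := hT
        obtain ⟨h1, h2, h3⟩ := hL P hP
        exact ((hMs P.1 h1 T' hT').mono (Set.subset_insert _ _)).concat h2
    · have heq : V ∩ {i : Fin n | k ≤ (i : ℕ)} = V ∩ {i : Fin n | k + 1 ≤ (i : ℕ)} := by
        refine Set.Subset.antisymm (fun i hi => ⟨hi.1, ?_⟩) hsub
        have h1 : k ≤ (i : ℕ) := hi.2
        have h2 : (i : ℕ) ≠ k := fun h =>
          hkV (by rw [← show i = ⟨k, hk⟩ from Fin.ext h]; exact hi.1)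
        change k + 1 ≤ (i : ℕ)
        omega
      rw [heq] at hS ⊢
      exact ih S hS

end

section

variable {K : Type*} [Field K] {n : ℕ}

/-! ### Elimination trees -/

lemma IsParent.unique {G : SimpleGraph (Fin n)} {l p q : Fin n} (hp : IsParent G l p)
    (hq : IsParent G l q) : p = q :=
  le_antisymm (hp.2.2 q hq.1 hq.2.1) (hq.2.2 p hp.1 hp.2.1)

lemma exists_isParent {G : SimpleGraph (Fin n)} {l m : Fin n} (h : G.Adj l m) (hlm : l < m) :
    ∃ p, IsParent G l p := by
  classical
  let s : Finset (Fin n) := Finset.univ.filter fun m => G.Adj l m ∧ l < m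
  have hs : s.Nonempty := ⟨m, by simp [s, h, hlm]⟩
  have h1 : G.Adj l (s.min' hs) ∧ l < s.min' hs := by simpa [s] using s.min'_mem hs
  exact ⟨s.min' hs, h1.1, h1.2, fun m h2 h3 => s.min'_le m (by simp [s, h2, h3])⟩

lemma cliqueAt_subset (G : SimpleGraph (Fin n)) (l : Fin n) :
    cliqueAt G l ⊆ {i | (l : ℕ) ≤ i} := by
  rintro i (rfl | hi)
  · exact le_rfl (a := (i : ℕ))
  · exact (Fin.lt_def.1 hi.2).le

lemma cliqueAt_eq_of_forall_not_isParent {G : SimpleGraph (Fin n)} {l : Fin n}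
    (h : ∀ p, ¬ IsParent G l p) : cliqueAt G l = {l} := by
  ext i
  constructor
  · rintro (rfl | hi)
    · rfl
    · exact absurd (exists_isParent hi.1 hi.2) (by push Not; exact h)
  · rintro rfl
    exact Set.mem_insert _ _

/-- A polynomial in `K[X_l]` without `x_l` has only variables from the parent of `x_l` on. -/
lemma mem_supported_parent {G : SimpleGraph (Fin n)} {l p : Fin n} (hp : IsParent G l p)
    {f : MvPolynomial (Fin n) K} (hf : f ∈ supported K (cliqueAt G l))
    (hl : f ∈ supported K {i : Fin n | (l : ℕ) + 1 ≤ i}) :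
    f ∈ supported K {i : Fin n | (p : ℕ) ≤ i} := by
  rw [mem_supported] at *
  intro i hi
  have h1 : (l : ℕ) + 1 ≤ i := hl hi
  rcases hf hi with rfl | h
  · omega
  · exact hp.2.2 i h.1 h.2

/-- In a perfect elimination ordering, the part of `X_l` from the parent of `x_l` on belongs to
the set `X_p` of the parent. -/
lemma mem_supported_cliqueAt_parent {G : SimpleGraph (Fin n)} (hG : IsPerfectEliminationOrdering G)
    {l p : Fin n} (hp : IsParent G l p) {f : MvPolynomial (Fin n) K}
    (hf : f ∈ supported K (cliqueAt G l)) (hfp : f ∈ supported K {i : Fin n | (p : ℕ) ≤ i}) :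
    f ∈ supported K (cliqueAt G p) := by
  rw [mem_supported] at *
  intro i hi
  have h1 : p ≤ i := hfp hi
  rcases eq_or_lt_of_le h1 with rfl | h2
  · exact Set.mem_insert _ _
  · exact Or.inr ⟨hG l (Or.inr ⟨hp.1, hp.2.1⟩) (hf hi) h2.ne, h2⟩

/-! ### Zeros of upward paths -/

/-- `UpZeros G N x v`: the point `x` is a common zero of the systems along some path of the
network that starts at `v` and follows the arcs up to a node whose rank has no parent. -/
inductive UpZeros (G : SimpleGraph (Fin n)) (N : Network n (PolySystem K n))
    (x : Fin n → AlgebraicClosure K) : N.Node → Prop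
  | root (v : N.Node) (hx : x ∈ (N.content v).zeros) (h : ∀ p, ¬ IsParent G (N.rank v) p) :
      UpZeros G N x v
  | step (v w : N.Node) (hx : x ∈ (N.content v).zeros) (h : N.Arc v w) (hw : UpZeros G N x w) :
      UpZeros G N x v

/-- As `UpZeros`, but without the condition that `x` is a zero of the system of `v` itself. -/
def Above (G : SimpleGraph (Fin n)) (N : Network n (PolySystem K n))
    (x : Fin n → AlgebraicClosure K) (v : N.Node) : Prop :=
  (∀ p, ¬ IsParent G (N.rank v) p) ∨ ∃ w, N.Arc v w ∧ UpZeros G N x w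

lemma upZeros_iff {G : SimpleGraph (Fin n)} {N : Network n (PolySystem K n)}
    {x : Fin n → AlgebraicClosure K} {v : N.Node} :
    UpZeros G N x v ↔ x ∈ (N.content v).zeros ∧ Above G N x v := by
  constructor
  · rintro (⟨_, hx, h⟩ | ⟨_, w, hx, h, hw⟩)
    · exact ⟨hx, Or.inl h⟩
    · exact ⟨hx, Or.inr ⟨w, h, hw⟩⟩
  · rintro ⟨hx, h | ⟨w, h, hw⟩⟩
    · exact .root v hx h
    · exact .step v w hx h hw

/-- A node to which the rounds of triangularization are no longer applied: what is left has main
variable `x_k`, `k` the rank, and satisfies the property `P` over the zeros of the paths above. -/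
structure IsDone (P : Fin n → MvPolynomial (Fin n) K → (Fin n → AlgebraicClosure K) → Prop)
    (G : SimpleGraph (Fin n)) (N : Network n (PolySystem K n)) (v : N.Node) : Prop where
  eqs : (N.content v).eqs = ∅ ∨ ∃ f, (N.content v).eqs = {f} ∧ IsMainVar f (N.rank v)
  ineqs_ne_zero : ∀ u ∈ (N.content v).ineqs, u ≠ 0
  ineqs_mainVar : ∀ u ∈ (N.content v).ineqs, ∀ k, IsMainVar u k → k = N.rank v
  eqs_or_ineqs : (N.content v).eqs = ∅ ∨ ∀ u ∈ (N.content v).ineqs, ¬ IsMainVar u (N.rank v)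
  prop : ∀ x, Above G N x v → ∀ f, f ∈ (N.content v).eqs ∨ f ∈ (N.content v).ineqs →
    IsMainVar f (N.rank v) → P (N.rank v) f x

/-- The invariant of chordal triangularization after the rounds `0, ..., m-1`. The condition
`sound` concerns single upward paths, not whole chains: this makes it stable under merges, which
create new chains. -/
structure NetworkInvariant
    (P : Fin n → MvPolynomial (Fin n) K → (Fin n → AlgebraicClosure K) → Prop)
    (G : SimpleGraph (Fin n)) (F : Finset (MvPolynomial (Fin n) K)) (m : ℕ)
    (N : Network n (PolySystem K n)) : Prop where
  arc : ∀ v w, N.Arc v w → IsParent G (N.rank v) (N.rank w)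
  supported : ∀ v, (N.content v).SupportedIn (cliqueAt G (N.rank v))
  sound : ∀ v x, UpZeros G N x v →
    ∀ f ∈ F, f ∈ MvPolynomial.supported K (cliqueAt G (N.rank v)) → aeval x f = 0
  complete : ∀ x ∈ variety F, ∃ c, IsChain G N c ∧ ∀ l, x ∈ (N.content (c l)).zeros
  done : ∀ v, (N.rank v : ℕ) < m → IsDone P G N v

/-- A regular system whose polynomials satisfy the property `P` over the zeros of the system in
the smaller variables. -/
def IsRegularWith (P : Fin n → MvPolynomial (Fin n) K → (Fin n → AlgebraicClosure K) → Prop)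
    (S : PolySystem K n) : Prop :=
  IsRegularSystem S ∧ ∀ k f, f ∈ S.eqs ∨ f ∈ S.ineqs → IsMainVar f k →
    ∀ x ∈ (S.elim ((k : ℕ) + 1)).zeros, P k f x

/-! ### Merging -/

lemma Mergeable.zeros_eq {S S' : PolySystem K n} (h : Mergeable S S') : S.zeros = S'.zeros := by
  have key : ∀ {S S' : PolySystem K n}, Mergeable S S' → S.zeros ⊆ S'.zeros := by
    intro S S' h x hx
    refine ⟨fun f hf => aeval_eq_zero_of_mem_span hx.1 ?_, fun f hf => hx.2 f (h.2 ▸ hf)⟩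
    rw [h.1]
    exact Ideal.subset_span hf
  exact Set.Subset.antisymm (key h) (key ⟨h.1.symm, h.2.symm⟩)

variable {G : SimpleGraph (Fin n)} {F : Finset (MvPolynomial (Fin n) K)}
  {P : Fin n → MvPolynomial (Fin n) K → (Fin n → AlgebraicClosure K) → Prop}
  {m : ℕ} {N : Network n (PolySystem K n)}

lemma merge_arc_rank (hN : ∀ v w, N.Arc v w → IsParent G (N.rank v) (N.rank w)) {u v : N.Node}
    (huv : N.rank u = N.rank v) (a b : (merge N u v).Node) (h : (merge N u v).Arc a b) :
    IsParent G ((merge N u v).rank a) ((merge N u v).rank b) := by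
  rcases h with h | ⟨h1, h2⟩ | ⟨h1, h2⟩
  · exact hN _ _ h
  · have := hN _ _ h2
    rw [← huv, ← h1] at this
    exact this
  · have := hN _ _ h2
    rw [← huv, ← h1] at this
    exact this

/-- Chains survive a merge. -/
lemma merge_complete (hN : ∀ v w, N.Arc v w → IsParent G (N.rank v) (N.rank w)) {u v : N.Node}
    (hne : u ≠ v) (huv : N.rank u = N.rank v) (hc : Mergeable (N.content u) (N.content v))
    {x : Fin n → AlgebraicClosure K}
    (h : ∃ c, IsChain G N c ∧ ∀ l, x ∈ (N.content (c l)).zeros) :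
    ∃ c, IsChain G (merge N u v) c ∧ ∀ l, x ∈ ((merge N u v).content (c l)).zeros := by
  classical
  obtain ⟨c, ⟨hr, ha⟩, hx⟩ := h
  let σ : N.Node → (merge N u v).Node := fun w => if hw : w = v then ⟨u, hne⟩ else ⟨w, hw⟩
  have hσv : σ v = ⟨u, hne⟩ := dif_pos rfl
  have hσ : ∀ w (hw : w ≠ v), σ w = ⟨w, hw⟩ := fun w hw => dif_neg hw
  have hσr : ∀ w, (merge N u v).rank (σ w) = N.rank w := by
    intro w
    by_cases hw : w = v
    · subst hw; rw [hσv]; exact huv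
    · rw [hσ w hw]; rfl
  have hσa : ∀ a b, N.Arc a b → (merge N u v).Arc (σ a) (σ b) := by
    intro a b hab
    by_cases haw : a = v <;> by_cases hbw : b = v
    · subst haw; subst hbw
      exact absurd (hN _ _ hab).2.1 (lt_irrefl _)
    · subst haw
      rw [hσv, hσ b hbw]
      exact Or.inr (Or.inr ⟨rfl, hab⟩)
    · subst hbw
      rw [hσv, hσ a haw]
      exact Or.inr (Or.inl ⟨rfl, hab⟩)
    · rw [hσ a haw, hσ b hbw]
      exact Or.inl hab
  refine ⟨fun l => σ (c l), ⟨fun l => (hσr _).trans (hr l), fun l p hlp => hσa _ _ (ha l p hlp)⟩,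
    fun l => ?_⟩
  by_cases hw : c l = v
  · have := hx l
    rw [hw, ← hc.zeros_eq] at this
    simp only [hw, hσv]
    exact this
  · simp only [hσ _ hw]
    exact hx l

/-- Merging two nodes with the same outgoing arcs creates no new upward paths, up to systems with
the same zeros. -/
lemma mergeOut_upZeros {u v : N.Node} (huv : N.rank u = N.rank v)
    (hc : Mergeable (N.content u) (N.content v)) (harc : ∀ w, N.Arc u w ↔ N.Arc v w)
    {x : Fin n → AlgebraicClosure K} {a b : (merge N u v).Node} (hab : (merge N u v).Arc a b)
    (hb : UpZeros G N x b.1) : ∃ w, N.Arc a.1 w ∧ UpZeros G N x w := by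
  rcases hab with h | ⟨h1, h2⟩ | ⟨h1, h2⟩
  · exact ⟨_, h, hb⟩
  · refine ⟨v, h2, ?_⟩
    rw [h1, upZeros_iff, hc.zeros_eq, Above, huv] at hb
    simp only [harc] at hb
    exact upZeros_iff.2 hb
  · exact ⟨b.1, by rw [h1, harc]; exact h2, hb⟩

lemma NetworkInvariant.merge_out (hN : NetworkInvariant P G F m N) {u v : N.Node} (hne : u ≠ v)
    (huv : N.rank u = N.rank v) (hc : Mergeable (N.content u) (N.content v))
    (harc : ∀ w, N.Arc u w ↔ N.Arc v w) : NetworkInvariant P G F m (merge N u v) := by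
  have hup : ∀ {x a}, UpZeros G (merge N u v) x a → UpZeros G N x a.1 := by
    intro x a h
    induction h with
    | root a hx h => exact .root _ hx h
    | step a b hx h _ ih =>
      obtain ⟨w, hw, hw'⟩ := mergeOut_upZeros huv hc harc h ih
      exact .step _ w hx hw hw'
  have habove : ∀ {x a}, Above G (merge N u v) x a → Above G N x a.1 := by
    rintro x a (h | ⟨b, hab, hb⟩)
    · exact Or.inl h
    · exact Or.inr (mergeOut_upZeros huv hc harc hab (hup hb))
  refine ⟨merge_arc_rank hN.arc huv, fun a => hN.supported a.1, fun a x h => hN.sound a.1 x (hup h),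
    fun x hx => merge_complete hN.arc hne huv hc (hN.complete x hx), fun a ha => ?_⟩
  obtain ⟨h1, h2, h3, h4, h5⟩ := hN.done a.1 ha
  exact ⟨h1, h2, h3, h4, fun x hx => h5 x (habove hx)⟩

/-- Merging two nodes `u`, `v` with the same incoming arcs creates no new upward paths, up to an
exchange of the systems of `u` and `v`. -/
lemma mergeIn_upZeros {u v : N.Node} (harc : ∀ w, N.Arc w u ↔ N.Arc w v)
    {x : Fin n → AlgebraicClosure K} {a b : (merge N u v).Node} (hab : (merge N u v).Arc a b)
    (hb : UpZeros G N x b.1 ∨ (b.1 = u ∧ UpZeros G N x v)) :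
    (∃ w, N.Arc a.1 w ∧ UpZeros G N x w) ∨ (a.1 = u ∧ ∃ w, N.Arc v w ∧ UpZeros G N x w) := by
  rcases hab with h | ⟨h1, h2⟩ | ⟨h1, h2⟩
  · rcases hb with hb | ⟨hb, hv⟩
    · exact Or.inl ⟨_, h, hb⟩
    · rw [hb, harc] at h
      exact Or.inl ⟨_, h, hv⟩
  · rcases hb with hb | ⟨hb, hv⟩
    · rw [h1] at hb
      exact Or.inl ⟨u, (harc _).2 h2, hb⟩
    · exact Or.inl ⟨v, h2, hv⟩
  · rcases hb with hb | ⟨hb, hv⟩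
    · exact Or.inr ⟨h1, _, h2, hb⟩
    · rw [hb, harc] at h2
      exact Or.inr ⟨h1, _, h2, hv⟩

/-- Generators of the same principal ideal agree up to a nonzero constant. -/
lemma exists_eq_C_mul_of_span_eq {f g : MvPolynomial (Fin n) K}
    (h : Ideal.span {f} = Ideal.span {g}) : ∃ c : K, c ≠ 0 ∧ f = C c * g := by
  obtain ⟨u, hu⟩ := Ideal.span_singleton_eq_span_singleton.1 h.symm
  obtain ⟨c, hc, hcu⟩ := MvPolynomial.isUnit_iff_eq_C_of_isReduced.1 u.isUnit
  exact ⟨c, hc.ne_zero, by rw [← hu, hcu, mul_comm]⟩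

lemma NetworkInvariant.merge_in
    (hP : ∀ k f x, ∀ c : K, c ≠ 0 → IsMainVar f k → P k f x → P k (C c * f) x)
    (hN : NetworkInvariant P G F m N) {u v : N.Node} (hne : u ≠ v)
    (huv : N.rank u = N.rank v) (hc : Mergeable (N.content u) (N.content v))
    (harc : ∀ w, N.Arc w u ↔ N.Arc w v) : NetworkInvariant P G F m (merge N u v) := by
  have hup : ∀ {x a}, UpZeros G (merge N u v) x a →
      UpZeros G N x a.1 ∨ (a.1 = u ∧ UpZeros G N x v) := by
    intro x a h
    induction h with
    | root a hx h => exact Or.inl (.root _ hx h)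
    | step a b hx h _ ih =>
      rcases mergeIn_upZeros harc h ih with ⟨w, hw, hw'⟩ | ⟨ha, w, hw, hw'⟩
      · exact Or.inl (.step _ w hx hw hw')
      · refine Or.inr ⟨ha, .step _ w ?_ hw hw'⟩
        have hx' : x ∈ (N.content a.1).zeros := hx
        rwa [ha, hc.zeros_eq] at hx'
  have habove : ∀ {x a}, Above G (merge N u v) x a →
      Above G N x a.1 ∨ (a.1 = u ∧ Above G N x v) := by
    rintro x a (h | ⟨b, hab, hb⟩)
    · exact Or.inl (Or.inl h)
    · exact (mergeIn_upZeros harc hab (hup hb)).imp Or.inr fun h => ⟨h.1, Or.inr h.2⟩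
  refine ⟨merge_arc_rank hN.arc huv, fun a => hN.supported a.1, fun a x h f hf hfs => ?_,
    fun x hx => merge_complete hN.arc hne huv hc (hN.complete x hx), fun a ha => ?_⟩
  · rcases hup h with h | ⟨h1, h2⟩
    · exact hN.sound a.1 x h f hf hfs
    · refine hN.sound v x h2 f hf ?_
      rw [← huv, ← h1]
      exact hfs
  · obtain ⟨h1, h2, h3, h4, h5⟩ := hN.done a.1 ha
    refine ⟨h1, h2, h3, h4, fun x hx f hf hfa => ?_⟩
    rcases habove hx with hx | ⟨hau, hxv⟩
    · exact h5 x hx f hf hfa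
    obtain ⟨a, hav⟩ := a
    dsimp only at hau
    subst hau
    have hdv := hN.done v (by rw [← huv]; exact ha)
    change P (N.rank a) f x
    change IsMainVar f (N.rank a) at hfa
    rw [huv] at hfa ⊢
    -- on paths that come from `v`, the polynomial of `u` is treated as that of `v`
    rcases hf with hf | hf
    · have hf : f ∈ (N.content a).eqs := hf
      have hsp := hc.1
      have hfeq : (N.content a).eqs = {f} := by
        rcases h1 with h1 | ⟨g, h1, -⟩
        · have h1 : (N.content a).eqs = ∅ := h1
          rw [h1] at hf
          simp at hf
        · have h1 : (N.content a).eqs = {g} := h1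
          rw [h1, Finset.mem_singleton] at hf
          rw [h1, hf]
      rcases hdv.eqs with hv | ⟨g, hv, hg⟩
      · rw [hfeq, hv, Finset.coe_singleton, Finset.coe_empty, Ideal.span_empty,
          Ideal.span_singleton_eq_bot] at hsp
        exact absurd hsp hfa.ne_zero
      · rw [hfeq, hv, Finset.coe_singleton, Finset.coe_singleton] at hsp
        obtain ⟨c, hc0, rfl⟩ := exists_eq_C_mul_of_span_eq hsp
        refine hP _ _ _ c hc0 hg (hdv.prop x hxv g (Or.inl ?_) hg)
        rw [hv]
        exact Finset.mem_singleton_self g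
    · have hf : f ∈ (N.content a).ineqs := hf
      rw [hc.2] at hf
      exact hdv.prop x hxv f (Or.inr hf) hfa

lemma NetworkInvariant.mergeOut {l : Fin n} {N' : Network n (PolySystem K n)}
    (hN : NetworkInvariant P G F m N) (h : MergeOut l N N') : NetworkInvariant P G F m N' := by
  induction h with
  | refl => exact hN
  | step N N' u v hne hu hv hc harc _ ih =>
    exact ih (hN.merge_out hne (hu.trans hv.symm) hc harc)

lemma NetworkInvariant.mergeIn
    (hP : ∀ k f x, ∀ c : K, c ≠ 0 → IsMainVar f k → P k f x → P k (C c * f) x)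
    {l : Fin n} {N' : Network n (PolySystem K n)}
    (hN : NetworkInvariant P G F m N) (h : MergeIn l N N') : NetworkInvariant P G F m N' := by
  induction h with
  | refl => exact hN
  | step N N' u v hne hu hv hc harc _ ih =>
    exact ih (hN.merge_in hP hne (hu.trans hv.symm) hc harc)

lemma mergeOut_forall_rank {Q : PolySystem K n → Prop} {l q : Fin n}
    {N' : Network n (PolySystem K n)} (h : MergeOut q N N')
    (hN : ∀ v, N.rank v = l → Q (N.content v)) : ∀ v, N'.rank v = l → Q (N'.content v) := by
  induction h with
  | refl => exact hN
  | step N N' u v hne hu hv hc harc _ ih => exact ih fun a ha => hN a.1 ha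

end

section

variable {K : Type*} [Field K] {n : ℕ}

variable {G : SimpleGraph (Fin n)} {F : Finset (MvPolynomial (Fin n) K)}
  {P : Fin n → MvPolynomial (Fin n) K → (Fin n → AlgebraicClosure K) → Prop}
  {D : PolySystem K n → Set (PolySystem K n) → Prop}
  {m : ℕ} {N N' : Network n (PolySystem K n)}

/-! ### Triangulation and elimination -/

lemma networkInvariant_induced : NetworkInvariant P G F 0 (induced G F) := by
  classical
  refine ⟨fun v w h => h, fun v => ⟨fun f hf => ?_, by simp [induced]⟩, fun v x hx f hf hfs => ?_,
    fun x hx => ⟨id, ⟨fun _ => rfl, fun _ _ h => h⟩, fun l => ⟨fun f hf => ?_, by simp [induced]⟩⟩,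
    fun v hv => absurd hv (Nat.not_lt_zero _)⟩
  · exact (Finset.mem_filter.1 hf).2
  · exact (upZeros_iff.1 hx).1.1 f (Finset.mem_filter.2 ⟨hf, hfs⟩)
  · exact hx f (Finset.mem_filter.1 hf).1

lemma NetworkInvariant.triangulate
    (hD : ∀ S 𝒯, D S 𝒯 → S.zeros = ⋃ T ∈ 𝒯, T.zeros ∧ ∀ T ∈ 𝒯, IsRegularWith P T)
    {l : Fin n} (hN : NetworkInvariant P G F l N) (h : Triangulate G D l N N') :
    NetworkInvariant P G F l N' ∧ ∀ v, N'.rank v = l → IsRegularWith P (N'.content v) := by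
  obtain ⟨k, T, h1, h2, rfl⟩ := h
  have hz : ∀ v x, x ∈ (N.content v).zeros ↔ ∃ i, x ∈ (T v i).zeros := by
    intro v x
    by_cases hv : N.rank v = l
    · rw [(hD _ _ (h1 v hv).1).1]
      simp
    · obtain ⟨hk, hT⟩ := h2 v hv
      simp only [hT]
      exact ⟨fun h => ⟨⟨0, by omega⟩, h⟩, fun ⟨_, h⟩ => h⟩
  have hup : ∀ {x a}, UpZeros G (replaceNodes N k T) x a → UpZeros G N x a.1 := by
    intro x a h
    induction h with
    | root a hx h => exact .root _ ((hz _ _).2 ⟨_, hx⟩) h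
    | step a b hx h _ ih => exact .step _ _ ((hz _ _).2 ⟨_, hx⟩) h ih
  refine ⟨⟨fun v w h => hN.arc _ _ h, fun v => ?_, fun v x hx => hN.sound v.1 x (hup hx),
    fun x hx => ?_, fun v hv => ?_⟩, fun v hv => ?_⟩
  · change (T v.1 v.2).SupportedIn (cliqueAt G (N.rank v.1))
    by_cases hv : N.rank v.1 = l
    · rw [hv]; exact (h1 v.1 hv).2 v.2
    · rw [(h2 v.1 hv).2]; exact hN.supported v.1
  · obtain ⟨c, ⟨hr, ha⟩, hc⟩ := hN.complete x hx
    choose i hi using fun l => (hz _ _).1 (hc l)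
    exact ⟨fun l => ⟨c l, i l⟩, ⟨hr, ha⟩, hi⟩
  · have hne : N.rank v.1 ≠ l := by
      rintro h
      have hv : (N.rank v.1 : ℕ) < l := hv
      rw [h] at hv
      exact lt_irrefl _ hv
    have hcont : (replaceNodes N k T).content v = N.content v.1 := (h2 v.1 hne).2 v.2
    obtain ⟨h1, h2, h3, h4, h5⟩ := hN.done v.1 hv
    refine ⟨by rw [hcont]; exact h1, by rw [hcont]; exact h2, by rw [hcont]; exact h3,
      by rw [hcont]; exact h4, fun x hx => ?_⟩
    rw [hcont]
    refine h5 x ?_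
    rcases hx with h | ⟨w, hw, hwx⟩
    · exact Or.inl h
    · exact Or.inr ⟨w.1, hw, hup hwx⟩
  · exact (hD _ _ (h1 v.1 hv).1).2 _ ⟨v.2, rfl⟩

/-- The polynomials of a node of rank `l` that are not passed on to the parent have main variable
`x_l`. -/
lemma isMainVar_of_notMem_supported {l p : Fin n} (hp : IsParent G l p)
    {f : MvPolynomial (Fin n) K} (hf : f ∈ supported K (cliqueAt G l))
    (hfp : f ∉ supported K {i : Fin n | (p : ℕ) ≤ i}) : IsMainVar f l :=
  (mem_supported_succ_or_isMainVar (supported_mono (cliqueAt_subset G l) hf)).resolve_left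
    fun h => hfp (mem_supported_parent hp hf h)

lemma eqs_eq_empty_or_singleton {E : Finset (MvPolynomial (Fin n) K)} {l : Fin n}
    (h : ∀ f ∈ E, IsMainVar f l) (hu : ∀ f ∈ E, ∀ g ∈ E, f = g) :
    E = ∅ ∨ ∃ f, E = {f} ∧ IsMainVar f l := by
  rcases E.eq_empty_or_nonempty with h0 | ⟨f, hf⟩
  · exact Or.inl h0
  · refine Or.inr ⟨f, ?_, h f hf⟩
    ext g
    rw [Finset.mem_singleton]
    exact ⟨fun hg => hu g hg f hf, fun hg => hg ▸ hf⟩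

lemma NetworkInvariant.eliminate (hG : IsPerfectEliminationOrdering G) {l p : Fin n}
    (hp : IsParent G l p) (hN : NetworkInvariant P G F l N)
    (hreg : ∀ v, N.rank v = l → IsRegularWith P (N.content v)) :
    NetworkInvariant P G F ((l : ℕ) + 1) (eliminate N l p) := by
  classical
  have hlp : l < p := hp.2.1
  have hrank : ∀ e : ElimArc N l, N.rank e.1.2 = p := by
    intro e
    have := hN.arc _ _ e.2.2
    rw [e.2.1] at this
    exact this.unique hp
  have hsplit : ∀ (S : PolySystem K n) x, x ∈ (S.diff (S.elim p)).zeros → x ∈ (S.elim p).zeros →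
      x ∈ S.zeros := by
    rintro S x ⟨h1, h2⟩ ⟨h3, h4⟩
    refine ⟨fun f hf => ?_, fun f hf => ?_⟩
    · by_cases hfp : f ∈ (S.elim p).eqs
      · exact h3 f hfp
      · exact h1 f (Finset.mem_sdiff.2 ⟨hf, hfp⟩)
    · by_cases hfp : f ∈ (S.elim p).ineqs
      · exact h4 f hfp
      · exact h2 f (Finset.mem_sdiff.2 ⟨hf, hfp⟩)
  have hdiff : ∀ S : PolySystem K n, S.zeros ⊆ (S.diff (S.elim p)).zeros := fun S x hx =>
    ⟨fun f hf => hx.1 f (Finset.mem_sdiff.1 hf).1, fun f hf => hx.2 f (Finset.mem_sdiff.1 hf).1⟩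
  have hcl : ∀ v, N.rank v = l → (ChordalNet.eliminate N l p).content (.inl v) =
      (N.content v).diff ((N.content v).elim p) := fun v hv => if_pos hv
  have hcn : ∀ v, N.rank v ≠ l → (ChordalNet.eliminate N l p).content (.inl v) = N.content v :=
    fun v hv => if_neg hv
  have hce : ∀ e : ElimArc N l, (ChordalNet.eliminate N l p).content (.inr e) =
      (N.content e.1.2).concat ((N.content e.1.1).elim p) := fun e => rfl
  -- above a node of rank `l`, the part that was passed on is recovered from the new node
  have hpass : ∀ {x v}, N.rank v = l → ∀ {b}, (ChordalNet.eliminate N l p).Arc (.inl v) b →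
      x ∈ ((ChordalNet.eliminate N l p).content b).zeros → x ∈ ((N.content v).elim p).zeros := by
    rintro x v hv b ⟨-, h⟩ hx
    obtain ⟨e, rfl, he⟩ := h hv
    rw [hce, PolySystem.zeros_concat] at hx
    rw [Sum.inl.inj he]
    exact hx.2
  have hbase : ∀ {x a b}, (ChordalNet.eliminate N l p).Arc a b →
      x ∈ ((ChordalNet.eliminate N l p).content a).zeros →
      x ∈ ((ChordalNet.eliminate N l p).content b).zeros →
      x ∈ (N.content (elimBase N l a)).zeros := by
    intro x a b hab ha hb
    rcases a with v | e
    · by_cases hv : N.rank v = l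
      · rw [hcl v hv] at ha
        exact hsplit _ _ ha (hpass hv hab hb)
      · rwa [hcn v hv] at ha
    · rw [hce, PolySystem.zeros_concat] at ha
      exact ha.1
  have hup : ∀ {x a}, UpZeros G (ChordalNet.eliminate N l p) x a →
      UpZeros G N x (elimBase N l a) := by
    intro x a h
    induction h with
    | root a hx h =>
      refine .root _ ?_ h
      rcases a with v | e
      · have hv : N.rank v ≠ l := by
          rintro rfl
          exact h p hp
        rwa [hcn v hv] at hx
      · rw [hce, PolySystem.zeros_concat] at hx
        exact hx.1
    | step a b hx h hb ih => exact .step _ _ (hbase h hx (upZeros_iff.1 hb).1) h.1 ih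
  have habove : ∀ {x a}, Above G (ChordalNet.eliminate N l p) x a →
      Above G N x (elimBase N l a) := by
    rintro x a (h | ⟨b, hab, hb⟩)
    · exact Or.inl h
    · exact Or.inr ⟨_, hab.1, hup hb⟩
  refine ⟨fun a b h => hN.arc _ _ h.1, fun a => ?_, fun a x h => hN.sound _ x (hup h),
    fun x hx => ?_, fun a ha => ?_⟩
  · rcases a with v | e
    · change ((ChordalNet.eliminate N l p).content (.inl v)).SupportedIn (cliqueAt G (N.rank v))
      have := hN.supported v
      by_cases hv : N.rank v = l
      · rw [hcl v hv]
        exact ⟨fun f hf => this.1 f (Finset.mem_sdiff.1 hf).1,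
          fun f hf => this.2 f (Finset.mem_sdiff.1 hf).1⟩
      · rwa [hcn v hv]
    · change ((ChordalNet.eliminate N l p).content (.inr e)).SupportedIn
        (cliqueAt G (N.rank e.1.2))
      rw [hce]
      refine (hN.supported e.1.2).concat ?_
      have := hN.supported e.1.1
      rw [e.2.1] at this
      rw [hrank e]
      constructor <;> intro f hf <;> have hf := Finset.mem_filter.1 hf
      · exact mem_supported_cliqueAt_parent hG hp (this.1 f hf.1) hf.2
      · exact mem_supported_cliqueAt_parent hG hp (this.2 f hf.1) hf.2
  · obtain ⟨c, ⟨hr, harc⟩, hc⟩ := hN.complete x hx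
    -- the chain passes through the new node that belongs to its arc from rank `l` to rank `p`
    let e : ElimArc N l := ⟨(c l, c p), hr l, harc l p hp⟩
    let c' : Fin n → N.Node ⊕ ElimArc N l := fun j => if j = p then .inr e else .inl (c j)
    have hc'p : c' p = .inr e := if_pos rfl
    have hc'n : ∀ j, j ≠ p → c' j = .inl (c j) := fun j hj => if_neg hj
    have hb : ∀ j, elimBase N l (c' j) = c j := by
      intro j
      by_cases hj : j = p
      · subst hj; rw [hc'p]; rfl
      · rw [hc'n j hj]; rfl
    refine ⟨c', ⟨fun j => ?_, fun a b hab => ⟨?_, fun hal => ?_⟩⟩, fun j => ?_⟩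
    · change N.rank (elimBase N l (c' j)) = j
      rw [hb, hr]
    · rw [hb, hb]
      exact harc a b hab
    · rw [hb, hr] at hal
      subst hal
      rw [hab.unique hp]
      exact ⟨e, hc'p, hc'n a hlp.ne⟩
    · by_cases hj : j = p
      · subst hj
        rw [hc'p, hce, PolySystem.zeros_concat]
        exact ⟨hc _, zeros_subset_zeros_elim _ _ (hc l)⟩
      · rw [hc'n j hj]
        by_cases hjl : N.rank (c j) = l
        · rw [hcl _ hjl]
          exact hdiff _ (hc j)
        · rw [hcn _ hjl]
          exact hc j
  · rcases a with v | e
    · have hrv : (N.rank v : ℕ) < l + 1 := ha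
      by_cases hv : N.rank v = l
      · obtain ⟨hS, hSP⟩ := hreg v hv
        have hsupp := hN.supported v
        rw [hv] at hsupp
        have hrk : (ChordalNet.eliminate N l p).rank (.inl v) = l := hv
        have hE : ∀ f ∈ ((N.content v).diff ((N.content v).elim p)).eqs,
            f ∈ (N.content v).eqs ∧ IsMainVar f l := by
          intro f hf
          obtain ⟨h1, h2⟩ := Finset.mem_sdiff.1 hf
          refine ⟨h1, isMainVar_of_notMem_supported hp (hsupp.1 f h1) fun h => h2 ?_⟩
          exact Finset.mem_filter.2 ⟨h1, h⟩
        have hI : ∀ f ∈ ((N.content v).diff ((N.content v).elim p)).ineqs,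
            f ∈ (N.content v).ineqs ∧ IsMainVar f l := by
          intro f hf
          obtain ⟨h1, h2⟩ := Finset.mem_sdiff.1 hf
          refine ⟨h1, isMainVar_of_notMem_supported hp (hsupp.2 f h1) fun h => h2 ?_⟩
          exact Finset.mem_filter.2 ⟨h1, h⟩
        have heqs := eqs_eq_empty_or_singleton (fun f hf => (hE f hf).2) fun f hf g hg =>
          hS.triangular.2 f (hE f hf).1 g (hE g hg).1 l (hE f hf).2 (hE g hg).2
        constructor <;> rw [hcl v hv] <;> try rw [hrk]
        · exact heqs
        · exact fun u hu => hS.ineqs_ne_zero u (hI u hu).1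
        · exact fun u hu k hk => hk.unique (hI u hu).2
        · refine (hS.eqs_or_ineqs l).imp (fun h => ?_) fun h u hu => h u (hI u hu).1
          rw [Finset.eq_empty_iff_forall_notMem]
          exact fun f hf => h f (hE f hf).1 (hE f hf).2
        · intro x hx f hf hfl
          have hxp : x ∈ ((N.content v).elim p).zeros := by
            rcases hx with h | ⟨b, hab, hb⟩
            · rw [hrk] at h
              exact absurd hp (h p)
            · exact hpass hv hab (upZeros_iff.1 hb).1
          refine hSP l f (hf.imp (fun h => (hE f h).1) fun h => (hI f h).1) hfl x ⟨?_, ?_⟩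
          · intro g hg
            obtain ⟨h1, h2⟩ := Finset.mem_filter.1 hg
            exact hxp.1 g (Finset.mem_filter.2 ⟨h1, mem_supported_parent hp (hsupp.1 g h1) h2⟩)
          · intro g hg
            obtain ⟨h1, h2⟩ := Finset.mem_filter.1 hg
            exact hxp.2 g (Finset.mem_filter.2 ⟨h1, mem_supported_parent hp (hsupp.2 g h1) h2⟩)
      · have hlt : (N.rank v : ℕ) < l := by
          have : (N.rank v : ℕ) ≠ l := fun h => hv (Fin.ext h)
          omega
        obtain ⟨h1, h2, h3, h4, h5⟩ := hN.done v hlt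
        constructor <;> rw [hcn v hv]
        · exact h1
        · exact h2
        · exact h3
        · exact h4
        · exact fun x hx => h5 x (habove hx)
    · have h1 : (N.rank e.1.2 : ℕ) < l + 1 := ha
      rw [hrank e] at h1
      have h2 : (l : ℕ) < p := hlp
      omega

/-- If `x_l` has no parent, the nodes of rank `l` are univariate and there is nothing to
eliminate. -/
lemma NetworkInvariant.succ_of_no_parent {l : Fin n} (hp : ∀ p, ¬ IsParent G l p)
    (hN : NetworkInvariant P G F l N)
    (hreg : ∀ v, N.rank v = l → IsRegularWith P (N.content v)) :
    NetworkInvariant P G F ((l : ℕ) + 1) N := by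
  classical
  refine ⟨hN.arc, hN.supported, hN.sound, hN.complete, fun v hv => ?_⟩
  rcases Nat.lt_succ_iff_lt_or_eq.1 hv with hlt | heq
  · exact hN.done v hlt
  have hvl : N.rank v = l := Fin.ext heq
  obtain ⟨hS, hSP⟩ := hreg v hvl
  have hsupp := hN.supported v
  rw [hvl, cliqueAt_eq_of_forall_not_isParent hp] at hsupp
  have hmv : ∀ f ∈ MvPolynomial.supported K ({l} : Set (Fin n)), ∀ k, IsMainVar f k → k = l :=
    fun f hf k hk => mem_supported.1 hf hk.1
  have hE : ∀ f ∈ (N.content v).eqs, IsMainVar f l := by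
    intro f hf
    obtain ⟨k, hk⟩ := hS.triangular.1 f hf
    rwa [hmv f (hsupp.1 f hf) k hk] at hk
  refine ⟨?_, hS.ineqs_ne_zero, ?_, ?_, ?_⟩ <;> rw [hvl]
  · exact eqs_eq_empty_or_singleton hE fun f hf g hg =>
      hS.triangular.2 f hf g hg l (hE f hf) (hE g hg)
  · exact fun u hu k hk => hmv u (hsupp.2 u hu) k hk
  · refine (hS.eqs_or_ineqs l).imp_left fun h => ?_
    rw [Finset.eq_empty_iff_forall_notMem]
    exact fun f hf => h f hf (hE f hf)
  · intro x _ f hf hfl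
    refine hSP l f hf hfl x ⟨fun g hg => ?_, fun g hg => ?_⟩
    · obtain ⟨h1, h2⟩ := Finset.mem_filter.1 hg
      exact absurd h2 ((hE g h1).notMem_supported (Nat.lt_succ_self _))
    · -- the remaining inequations are nonzero constants
      obtain ⟨h1, h2⟩ := Finset.mem_filter.1 hg
      have hvars : g.vars = ∅ := by
        rw [Finset.eq_empty_iff_forall_notMem]
        intro i hi
        have h3 : i = l := mem_supported.1 (hsupp.2 g h1) hi
        have h4 : (l : ℕ) + 1 ≤ i := mem_supported.1 h2 hi
        rw [h3] at h4
        omega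
      have hg0 := hS.ineqs_ne_zero g h1
      rw [vars_eq_empty_iff_eq_C] at hvars
      rw [hvars, ne_eq, C_eq_zero] at hg0
      rw [hvars, aeval_C, ne_eq, map_eq_zero]
      exact hg0

lemma NetworkInvariant.round (hG : IsPerfectEliminationOrdering G)
    (hP : ∀ k f x, ∀ c : K, c ≠ 0 → IsMainVar f k → P k f x → P k (C c * f) x)
    (hD : ∀ S 𝒯, D S 𝒯 → S.zeros = ⋃ T ∈ 𝒯, T.zeros ∧ ∀ T ∈ 𝒯, IsRegularWith P T)
    {l : Fin n} (hN : NetworkInvariant P G F l N) (h : Round G D l N N') :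
    NetworkInvariant P G F ((l : ℕ) + 1) N' := by
  obtain ⟨N₁, N₂, N₃, h1, h2, h3, h4⟩ := h
  obtain ⟨hN₁, hreg₁⟩ := hN.triangulate hD h1
  have hN₂ := hN₁.mergeOut h2
  have hreg₂ := mergeOut_forall_rank h2 hreg₁
  refine NetworkInvariant.mergeIn hP ?_ h4
  rcases h3 with ⟨p, hp, h⟩ | ⟨hp, rfl⟩
  · exact (hN₂.eliminate hG hp hreg₂).mergeOut h
  · exact hN₂.succ_of_no_parent hp hreg₂

theorem AfterRounds.networkInvariant (hG : IsPerfectEliminationOrdering G)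
    (hP : ∀ k f x, ∀ c : K, c ≠ 0 → IsMainVar f k → P k f x → P k (C c * f) x)
    (hD : ∀ S 𝒯, D S 𝒯 → S.zeros = ⋃ T ∈ 𝒯, T.zeros ∧ ∀ T ∈ 𝒯, IsRegularWith P T)
    (h : AfterRounds G D F m N) : NetworkInvariant P G F m N := by
  induction h with
  | start => exact networkInvariant_induced
  | round l N N' _ hr ih => exact ih.round hG hP hD hr

/-! ### The chains of the final network -/

/-- The polynomial system of a chain. -/
def chainSystem (N : Network n (PolySystem K n)) (c : Fin n → N.Node) : PolySystem K n :=
  open Classical in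
  ⟨Finset.univ.biUnion (fun l => (N.content (c l)).eqs),
    Finset.univ.biUnion (fun l => (N.content (c l)).ineqs)⟩

lemma mem_chainSystem_eqs {c : Fin n → N.Node} {f : MvPolynomial (Fin n) K} :
    f ∈ (chainSystem N c).eqs ↔ ∃ l, f ∈ (N.content (c l)).eqs := by
  simp [chainSystem]

lemma mem_chainSystem_ineqs {c : Fin n → N.Node} {f : MvPolynomial (Fin n) K} :
    f ∈ (chainSystem N c).ineqs ↔ ∃ l, f ∈ (N.content (c l)).ineqs := by
  simp [chainSystem]

lemma mem_zeros_chainSystem {c : Fin n → N.Node} {x : Fin n → AlgebraicClosure K} :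
    x ∈ (chainSystem N c).zeros ↔ ∀ l, x ∈ (N.content (c l)).zeros := by
  constructor
  · intro hx l
    exact ⟨fun f hf => hx.1 f (mem_chainSystem_eqs.2 ⟨l, hf⟩),
      fun f hf => hx.2 f (mem_chainSystem_ineqs.2 ⟨l, hf⟩)⟩
  · intro hx
    refine ⟨fun f hf => ?_, fun f hf => ?_⟩
    · obtain ⟨l, hl⟩ := mem_chainSystem_eqs.1 hf
      exact (hx l).1 f hl
    · obtain ⟨l, hl⟩ := mem_chainSystem_ineqs.1 hf
      exact (hx l).2 f hl

/-- A common zero of the nodes of a chain of rank at least `m` is a zero of the upward paths in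
the chain from these nodes. -/
lemma IsChain.upZeros {c : Fin n → N.Node} (hc : IsChain G N c) {x : Fin n → AlgebraicClosure K}
    {m : ℕ} (hx : ∀ j : Fin n, m ≤ (j : ℕ) → x ∈ (N.content (c j)).zeros) (j : Fin n)
    (hj : m ≤ (j : ℕ)) : UpZeros G N x (c j) := by
  induction j using WellFoundedGT.induction with
  | ind j ih =>
    by_cases h : ∃ p, IsParent G j p
    · obtain ⟨p, hp⟩ := h
      have hjp : (j : ℕ) < p := hp.2.1
      exact .step _ _ (hx j hj) (hc.2 j p hp) (ih p hp.2.1 (by omega))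
    · refine .root _ (hx j hj) ?_
      rw [hc.1]
      push Not at h
      exact h

/-- All nodes of rank greater than `k` of a chain belong to its elimination system in the variables
after `x_k`. -/
lemma NetworkInvariant.above (hN : NetworkInvariant P G F m N) {c : Fin n → N.Node}
    (hc : IsChain G N c) {k : Fin n} {x : Fin n → AlgebraicClosure K}
    (hx : x ∈ ((chainSystem N c).elim ((k : ℕ) + 1)).zeros) : Above G N x (c k) := by
  classical
  have hz : ∀ j : Fin n, (k : ℕ) + 1 ≤ j → x ∈ (N.content (c j)).zeros := by
    intro j hj
    have hs : MvPolynomial.supported K (cliqueAt G (N.rank (c j))) ≤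
        MvPolynomial.supported K {i : Fin n | (k : ℕ) + 1 ≤ i} := by
      rw [hc.1]
      exact supported_mono fun i hi => hj.trans (cliqueAt_subset G j hi)
    refine ⟨fun f hf => hx.1 f ?_, fun f hf => hx.2 f ?_⟩
    · exact Finset.mem_filter.2
        ⟨mem_chainSystem_eqs.2 ⟨j, hf⟩, hs ((hN.supported _).1 f hf)⟩
    · exact Finset.mem_filter.2
        ⟨mem_chainSystem_ineqs.2 ⟨j, hf⟩, hs ((hN.supported _).2 f hf)⟩
  by_cases h : ∃ p, IsParent G k p
  · obtain ⟨p, hp⟩ := h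
    exact Or.inr ⟨_, hc.2 k p hp, hc.upZeros hz p hp.2.1⟩
  · left
    rw [hc.1]
    push Not at h
    exact h

lemma NetworkInvariant.isRegularWith (hN : NetworkInvariant P G F n N)
    (hPi : ∀ k f x, P k f x → aeval x (initial f) ≠ 0) {c : Fin n → N.Node}
    (hc : IsChain G N c) : IsRegularWith P (chainSystem N c) := by
  have hd : ∀ l, IsDone P G N (c l) := fun l => hN.done _ (Fin.isLt _)
  have hE : ∀ l, ∀ f ∈ (N.content (c l)).eqs, IsMainVar f l := by
    intro l f hf
    rcases (hd l).eqs with h | ⟨g, h, hg⟩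
    · rw [h] at hf
      simp at hf
    · rw [h, Finset.mem_singleton] at hf
      rwa [hf, ← hc.1 l]
  have hI : ∀ l, ∀ f ∈ (N.content (c l)).ineqs, ∀ k, IsMainVar f k → k = l := by
    intro l f hf k hk
    rw [(hd l).ineqs_mainVar f hf k hk, hc.1]
  have key : ∀ k f, f ∈ (chainSystem N c).eqs ∨ f ∈ (chainSystem N c).ineqs → IsMainVar f k →
      ∀ x ∈ ((chainSystem N c).elim ((k : ℕ) + 1)).zeros, P k f x := by
    intro k f hf hk x hx
    have hf' : f ∈ (N.content (c k)).eqs ∨ f ∈ (N.content (c k)).ineqs := by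
      rcases hf with hf | hf
      · obtain ⟨l, hl⟩ := mem_chainSystem_eqs.1 hf
        rw [hk.unique (hE l f hl)]
        exact Or.inl hl
      · obtain ⟨l, hl⟩ := mem_chainSystem_ineqs.1 hf
        rw [hI l f hl k hk]
        exact Or.inr hl
    have := (hd k).prop x (hN.above hc hx) f hf'
    rw [hc.1] at this
    exact this hk
  refine ⟨⟨⟨?_, ?_⟩, ?_, ?_, fun k f hf hk x hx => hPi _ _ _ (key k f hf hk x hx)⟩, key⟩
  · intro f hf
    obtain ⟨l, hl⟩ := mem_chainSystem_eqs.1 hf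
    exact ⟨l, hE l f hl⟩
  · intro f hf g hg k hfk hgk
    obtain ⟨l, hl⟩ := mem_chainSystem_eqs.1 hf
    obtain ⟨l', hl'⟩ := mem_chainSystem_eqs.1 hg
    obtain rfl := hfk.unique (hE l f hl)
    obtain rfl := hgk.unique (hE l' g hl')
    rcases (hd k).eqs with h | ⟨t, h, -⟩
    · rw [h] at hl
      simp at hl
    · rw [h, Finset.mem_singleton] at hl hl'
      rw [hl, hl']
  · intro u hu
    obtain ⟨l, hl⟩ := mem_chainSystem_ineqs.1 hu
    exact (hd l).ineqs_ne_zero u hl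
  · intro k
    have := (hd k).eqs_or_ineqs
    rw [hc.1] at this
    refine this.imp (fun h f hf hk => ?_) fun h f hf hk => ?_
    · obtain ⟨l, hl⟩ := mem_chainSystem_eqs.1 hf
      obtain rfl := hk.unique (hE l f hl)
      rw [h] at hl
      simp at hl
    · obtain ⟨l, hl⟩ := mem_chainSystem_ineqs.1 hf
      obtain rfl := hI l f hl k hk
      exact h f hl hk

/-- The variables of a polynomial supported on `G` lie in one of the cliques `X_l`. -/
lemma exists_mem_supported_cliqueAt (hn : 0 < n) (hF : IsSupportedOn F G)
    {f : MvPolynomial (Fin n) K} (hf : f ∈ F) : ∃ l, f ∈ supported K (cliqueAt G l) := by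
  rcases f.vars.eq_empty_or_nonempty with h | h
  · exact ⟨⟨0, hn⟩, by rw [mem_supported, h]; simp⟩
  · obtain ⟨l, hl, hmin⟩ := exists_isMainVar h
    refine ⟨l, mem_supported.2 fun i hi => ?_⟩
    rcases eq_or_lt_of_le (hmin i hi) with rfl | hlt
    · exact Set.mem_insert _ _
    · exact Or.inr ⟨hF.2 ⟨hlt.ne, f, hf, hl, hi⟩, hlt⟩

lemma NetworkInvariant.variety_eq (hn : 0 < n) (hF : IsSupportedOn F G)
    (hN : NetworkInvariant P G F m N) :
    variety F = ⋃ T ∈ chainSystems G N, T.zeros := by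
  ext x
  simp only [Set.mem_iUnion]
  constructor
  · intro hx
    obtain ⟨c, hc, hcx⟩ := hN.complete x hx
    exact ⟨chainSystem N c, ⟨c, hc, rfl⟩, mem_zeros_chainSystem.2 hcx⟩
  · rintro ⟨_, ⟨c, hc, rfl⟩, hx⟩ f hf
    have hx : ∀ l, x ∈ (N.content (c l)).zeros := mem_zeros_chainSystem.1 hx
    obtain ⟨l, hl⟩ := exists_mem_supported_cliqueAt hn hF hf
    refine hN.sound (c l) x (hc.upZeros (m := 0) (fun j _ => hx j) l (Nat.zero_le _)) f hf ?_
    rwa [hc.1]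

end

section

variable {K : Type*} [Field K] {n : ℕ}

/-! ### Runs of chordal triangularization -/

lemma IsMainVar.initial_C_mul {f : MvPolynomial (Fin n) K} {k : Fin n} (h : IsMainVar f k) {c : K}
    (hc : c ≠ 0) : initial (C c * f) = C c * initial f := by
  rw [((isMainVar_C_mul hc).2 h).initial_eq, h.initial_eq, map_mul,
    toPoly_of_notMem_vars (f := C c) (by simp), Polynomial.leadingCoeff_mul,
    Polynomial.leadingCoeff_C]

lemma initial_aeval_C_mul_ne_zero (k : Fin n) (f : MvPolynomial (Fin n) K)
    (x : Fin n → AlgebraicClosure K) (c : K) (hc : c ≠ 0) (hf : IsMainVar f k)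
    (h : aeval x (initial f) ≠ 0) : aeval x (initial (C c * f)) ≠ 0 := by
  rw [hf.initial_C_mul hc, map_mul, aeval_C]
  exact mul_ne_zero (by rwa [ne_eq, map_eq_zero]) h

lemma squarefree_specialize_C_mul {k : Fin n} {f : MvPolynomial (Fin n) K}
    {x : Fin n → AlgebraicClosure K} {c : K} (hc : c ≠ 0) (h : Squarefree (specialize k x f)) :
    Squarefree (specialize k x (C c * f)) := by
  have hu : IsUnit (specialize k x (C c : MvPolynomial (Fin n) K)) := by
    rw [specialize, aeval_C]
    exact (isUnit_iff_ne_zero.2 hc).map _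
  have : specialize k x (C c * f) = specialize k x (C c) * specialize k x f := map_mul _ _ _
  rw [this]
  exact (associated_unit_mul_left _ _ hu).squarefree_iff.2 h

variable {G : SimpleGraph (Fin n)} {F : Finset (MvPolynomial (Fin n) K)} {m : ℕ}
  {N : Network n (PolySystem K n)}

/-- The invariant in runs with arbitrary triangular decompositions. -/
lemma AfterRounds.invariant (hG : IsPerfectEliminationOrdering G)
    (h : AfterRounds G IsTriangularDecomposition F m N) :
    NetworkInvariant (fun _ f x => aeval x (initial f) ≠ 0) G F m N :=
  h.networkInvariant hG initial_aeval_C_mul_ne_zero fun _ _ h => ⟨h.2, fun T hT =>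
    ⟨h.1 T hT, (h.1 T hT).initial_ne_zero⟩⟩

/-- The invariant in runs with squarefree triangular decompositions. -/
lemma AfterRounds.squarefree_invariant (hG : IsPerfectEliminationOrdering G)
    (h : AfterRounds G IsSquarefreeTriangularDecomposition F m N) :
    NetworkInvariant (fun k f x => aeval x (initial f) ≠ 0 ∧ Squarefree (specialize k x f))
      G F m N :=
  h.networkInvariant hG
    (fun k f x c hc hf h =>
      ⟨initial_aeval_C_mul_ne_zero k f x c hc hf h.1, squarefree_specialize_C_mul hc h.2⟩)
    fun _ _ h => ⟨h.2, fun T hT => ⟨(h.1 T hT).toIsRegularSystem, fun k f hf hk x hx =>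
      ⟨(h.1 T hT).initial_ne_zero k f hf hk x hx,
        (h.1 T hT).specialize_squarefree k f hf hk x hx⟩⟩⟩

lemma exists_triangulate [CharZero K] {l : Fin n}
    (hN : ∀ v, N.rank v = l → (N.content v).SupportedIn (cliqueAt G l)) :
    ∃ N', Triangulate G IsSquarefreeTriangularDecomposition l N N' := by
  have : ∀ v, ∃ (k : ℕ) (T : Fin k → PolySystem K n),
      (N.rank v = l → IsSquarefreeTriangularDecomposition (N.content v) (Set.range T) ∧
        ∀ i, (T i).SupportedIn (cliqueAt G l)) ∧
      (N.rank v ≠ l → k = 1 ∧ ∀ i, T i = N.content v) := by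
    intro v
    by_cases hv : N.rank v = l
    · obtain ⟨L, hL, hLs⟩ := exists_isSquarefreeTriangularDecomposition (cliqueAt G l)
        (Nat.zero_le n) (N.content v) (by simpa using hN v hv)
      refine ⟨L.length, L.get, fun _ => ⟨?_, fun i => ?_⟩, fun h => absurd hv h⟩
      · rwa [Set.range_list_get]
      · simpa using hLs _ (L.get_mem i)
    · exact ⟨1, fun _ => N.content v, fun h => absurd h hv, fun _ => ⟨rfl, fun _ => rfl⟩⟩
  choose k T h1 h2 using this
  exact ⟨_, k, T, h1, h2, rfl⟩

lemma exists_afterRounds_squarefree [CharZero K] (hG : IsPerfectEliminationOrdering G)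
    (hm : m ≤ n) :
    ∃ N, AfterRounds G IsSquarefreeTriangularDecomposition F m N := by
  induction m with
  | zero => exact ⟨_, .start⟩
  | succ m ih =>
    obtain ⟨N, hN⟩ := ih (by omega)
    let l : Fin n := ⟨m, hm⟩
    obtain ⟨N₁, h1⟩ := exists_triangulate (N := N) (l := l) fun v hv =>
      hv ▸ (hN.squarefree_invariant hG).supported v
    by_cases hp : ∃ p, IsParent G l p
    · obtain ⟨p, hp⟩ := hp
      exact ⟨_, .round l N _ hN ⟨N₁, N₁, _, h1, .refl _, Or.inl ⟨p, hp, .refl _⟩, .refl _⟩⟩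
    · push Not at hp
      exact ⟨_, .round l N _ hN ⟨N₁, N₁, _, h1, .refl _, Or.inr ⟨hp, rfl⟩, .refl _⟩⟩

end

end

end ChordalNet

theorem mainTheorem2 {K : Type*} [Field K] [CharZero K] {n : ℕ} (hn : 0 < n)
    (G : SimpleGraph (Fin n)) (F : Finset (MvPolynomial (Fin n) K))
    (hF : ChordalNet.IsSupportedOn F G) :
    -- every triangulation step of every run can be carried out, even with squarefree systems
    (∀ (l : Fin n) (N : ChordalNet.Network n (ChordalNet.PolySystem K n)),
      ChordalNet.AfterRounds G ChordalNet.IsTriangularDecomposition F l N →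
      ∃ N', ChordalNet.Triangulate G ChordalNet.IsSquarefreeTriangularDecomposition l N N') ∧
    -- hence there are complete runs, even squarefree ones
    (∃ N, ChordalNet.AfterRounds G ChordalNet.IsSquarefreeTriangularDecomposition F n N) ∧
    -- the output of every complete run
    (∀ N, ChordalNet.AfterRounds G ChordalNet.IsTriangularDecomposition F n N →
      ChordalNet.IsChordalNetwork G (ChordalNet.dropIneqs N) ∧
      ChordalNet.IsTriangularNetwork (ChordalNet.dropIneqs N) ∧
      ChordalNet.IsTriangularDecomposition ⟨F, ∅⟩ (ChordalNet.chainSystems G N) ∧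
      ChordalNet.IsRegularChainDecomposition F
        (ChordalNet.chainSets G (ChordalNet.dropIneqs N))) ∧
    -- the output of every complete run with squarefree triangulations
    (∀ N, ChordalNet.AfterRounds G ChordalNet.IsSquarefreeTriangularDecomposition F n N →
      ChordalNet.IsSquarefreeTriangularDecomposition ⟨F, ∅⟩ (ChordalNet.chainSystems G N)) := by
  have hzF : (⟨F, ∅⟩ : ChordalNet.PolySystem K n).zeros = ChordalNet.variety F := by
    ext x
    simp [ChordalNet.PolySystem.zeros, ChordalNet.variety]
  refine ⟨fun l N hN => ChordalNet.exists_triangulate fun v hv =>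
      hv ▸ (hN.invariant hF.1).supported v,
    ChordalNet.exists_afterRounds_squarefree hF.1 le_rfl, fun N hN => ?_, fun N hN => ?_⟩
  · have inv := hN.invariant hF.1
    have hreg : ∀ c, ChordalNet.IsChain G N c →
        ChordalNet.IsRegularSystem (ChordalNet.chainSystem N c) := fun c hc =>
      (inv.isRegularWith (fun _ _ _ h => h) hc).1
    have hvar := inv.variety_eq hn hF
    refine ⟨⟨fun v f hf => (inv.supported v).1 f hf, inv.arc⟩,
      fun v => (inv.done v (Fin.isLt _)).eqs, ⟨?_, hzF.trans hvar⟩, ?_, ?_⟩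
    · rintro _ ⟨c, hc, rfl⟩
      exact hreg c hc
    · rintro _ ⟨c, hc, rfl⟩
      exact (hreg c hc).isRegularChain
    · ext x
      simp only [Set.mem_iUnion]
      constructor
      · intro hx
        rw [hvar] at hx
        simp only [Set.mem_iUnion] at hx
        obtain ⟨_, ⟨c, hc, rfl⟩, hx⟩ := hx
        exact ⟨_, ⟨c, hc, rfl⟩, (hreg c hc).zeros_subset_quasiComponent hx⟩
      · rintro ⟨_, ⟨c, hc, rfl⟩, hx⟩ f hf
        refine (hreg c hc).aeval_eq_zero_of_mem_quasiComponent (fun y hy => ?_) hx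
        have : y ∈ ChordalNet.variety F := by
          rw [hvar]
          exact Set.mem_biUnion (show _ ∈ ChordalNet.chainSystems G N from ⟨c, hc, rfl⟩) hy
        exact this f hf
  · have inv := hN.squarefree_invariant hF.1
    refine ⟨?_, hzF.trans (inv.variety_eq hn hF)⟩
    rintro _ ⟨c, hc, rfl⟩
    have := inv.isRegularWith (fun _ _ _ h => h.1) hc
    exact ⟨this.1, fun k f hf hk x hx => (this.2 k f hf hk x hx).2⟩
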